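/- **Model.** A source (bandit) has a weight $w>0$, a bounded error function $p:\{0,1,2,\dots\}\to\mathbb R$ of the age of information, a buffer with positions $0,\dots,B-1$ ($B\ge 1$), and i.i.d. integer transmission times $T_0,T_1,\dots\ge 1$ with $\mathbb E[T_i]<\infty$. A causal policy chooses submission slots $S_0=0$, $S_{i+1}\ge D_i:=S_i+T_i$ and buffer positions $b_i\in\{0,\dots,B-1\}$, where $(S_i,b_i)$ depends on information that contains $T_0,\dots,T_{i-1}$ and is independent of $T_i$. The age is $\Delta(t)=t-S_i+b_i$ for $D_i\le t<D_{i+1}$ (and $\Delta(0)+t$ for $t<D_0$, with $\Delta(0)$ a constant), and $c(t)\in\{0,1\}$ indicates whether a feature is in service in slot $t$. For a transmission cost $\lambda\in\mathbb R$ let $$\bar p_{\rm opt}(\lambda)=\inf_{\text{causal policies}}\ \limsup_{N\to\infty}\frac1N\,\mathbb E\Big[\sum_{t=0}^{N-1}\big(w\,p(\Delta(t))+\lambda c(t)\big)\Big].$$ The state is $(\delta,d)$, where $\delta$ is the age and $d$ is the time already spent on the feature in service ($d=0$: idle). Let $\Omega(\lambda)$ be the set of states in which the passive action (not submitting a feature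 in the current slot) is optimal: $(\delta,d)\in\Omega(\lambda)$ iff $d>0$ (service is non-preemptive), or $d=0$ and waiting at least one slot is at least as good as submitting immediately in the average-cost Bellman equation with gain $\bar p_{\rm opt}(\lambda)$, i.e. (the other terms of that equation do not depend on the waiting time) $$\inf_{\tau\ge 1}\mathbb E\Big[\sum_{k=0}^{\tau+T_1-1}\big(w\,p(\delta+k)-\bar p_{\rm opt}(\lambda)\big)\Big]\ \le\ \mathbb E\Big[\sum_{k=0}^{T_1-1}\big(w\,p(\delta+k)-\bar p_{\rm opt}(\lambda)\big)\Big].$$ The Whittle index is $W(\delta,d)=\inf\{\lambda\in\mathbb R:(\delta,d)\in\Omega(\lambda)\}\in[-\infty,\infty]$. Let $$\gamma(\delta)=\inf_{\tau\in\{1,2,\dots\}}\frac1\tau\sum_{k=0}^{\tau-1}\mathbb E[w\,p(\delta+k+T_1)].$$ For $b\in\{0,\dots,B-1\}$ the $\gamma(\delta)$-threshold policy with buffer position $b$ is given by $S_0=0$, $D_i=S_i+T_i$, $S_{i+1}=\min\{t\ge D_i:\gamma(t-S_i+b)\ge\gamma(\delta)\}$. For an index $i\ge 0$ put $$W_b(\delta,0)=\frac{1}{\mathbb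 E[T_1]}\,\mathbb E[D_{i+1}-D_i]\,\gamma(\delta)-\frac1{\mathbb E[T_1]}\,\mathbb E\Big[\sum_{t=D_i}^{D_{i+1}-1}w\,p(t-S_i+b)\Big].$$ **Theorem.** Fix an age $\delta$, and consider the following condition (C) for $i\ge0$: the infimum defining $\gamma(\delta)$ is attained, and for every $b\in\{0,\dots,B-1\}$ the minimum defining $S_{i+1}$ almost surely exists and $\mathbb E[D_{i+1}-D_i]<\infty$. (0) If $\gamma(\delta)<\liminf_{n\to\infty}\frac1n\sum_{k=0}^{n-1}w\,p(k)$, then (C) holds for every $i\ge0$. (a) If (C) holds for $i$, then $W(\delta,0)=\max_{0\le b\le B-1}W_b(\delta,0)$, with $W_b(\delta,0)$ computed from the $i$-th interval. (b) If $d>0$, then $W(\delta,d)=-\infty$. -/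

import Mathlib

open MeasureTheory ProbabilityTheory Filter Finset

/-- A source bandit: weight `w > 0`, bounded inference-error function `p` of the age of
information, buffer size `B ≥ 1`, initial age, and i.i.d. integrable transmission times
`T 0, T 1, …`, each at least one slot. -/
structure Bandit {Ω : Type*} [MeasurableSpace Ω] (μ : Measure Ω) where
  w : ℝ
  w_pos : 0 < w
  p : ℕ → ℝ
  p_bounded : ∃ M : ℝ, ∀ δ, |p δ| ≤ M
  B : ℕ
  B_pos : 0 < B
  initialAge : ℕ
  T : ℕ → Ω → ℕ
  T_measurable : ∀ i, Measurable (T i)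
  one_le_T : ∀ i ω, 1 ≤ T i ω
  T_indep : iIndepFun T μ
  T_ident : ∀ i, IdentDistrib (T i) (T 0) μ μ
  T_integrable : Integrable (fun ω => (T 0 ω : ℝ)) μ

namespace Bandit

variable {Ω : Type*} [mΩ : MeasurableSpace Ω] {μ : Measure Ω}

/-- A causal scheduling policy of the bandit. Feature `i` is submitted in slot `S i` from buffer
position `b i`, and delivered in slot `S i + T i`. The σ-algebra `info i` is the information
available when feature `i` is submitted: it contains the earlier transmission times (and possibly
the randomization of the scheduler or the state of other sources), and the transmission time of
feature `i` is independent of it. Service is non-preemptive, and one feature at a time is served. -/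
structure Policy (A : Bandit μ) where
  info : Filtration ℕ mΩ
  S : ℕ → Ω → ℕ
  b : ℕ → Ω → ℕ
  S_measurable : ∀ i, Measurable[info i] (S i)
  b_measurable : ∀ i, Measurable[info i] (b i)
  T_observed : ∀ i, Measurable[info (i + 1)] (A.T i)
  T_indep_info : ∀ i, Indep (info i) (MeasurableSpace.comap (A.T i) ⊤) μ
  S_zero : ∀ ω, S 0 ω = 0
  nonpreemptive : ∀ i ω, S i ω + A.T i ω ≤ S (i + 1) ω
  b_lt : ∀ i ω, b i ω < A.B

namespace Policy

variable {A : Bandit μ}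

/-- Delivery slot of feature `i`. -/
def D (π : A.Policy) (i : ℕ) (ω : Ω) : ℕ := π.S i ω + A.T i ω

/-- Age of information: `Δ(t) = t - S i + b i` for `D i ≤ t < D (i + 1)`, and `Δ(0) + t` before
the first delivery. (Since `i < D i`, the index of the last delivered feature is at most `t`.) -/
noncomputable def age (π : A.Policy) (t : ℕ) (ω : Ω) : ℕ :=
  if t < π.D 0 ω then A.initialAge + t
  else
    t - π.S (Nat.findGreatest (fun i => π.D i ω ≤ t) t) ω
      + π.b (Nat.findGreatest (fun i => π.D i ω ≤ t) t) ω

open Classical in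
/-- Channel occupation `c(t) ∈ {0, 1}`: is a feature of the source in service in slot `t`? -/
noncomputable def occupied (π : A.Policy) (t : ℕ) (ω : Ω) : ℝ :=
  if ∃ i, π.S i ω ≤ t ∧ t < π.D i ω then 1 else 0

/-- Long-run expected average of the weighted inference error plus `l` per occupied slot. (The
averages are bounded, since `p` is.) -/
noncomputable def averageCost (π : A.Policy) (l : ℝ) : ℝ :=
  limsup (fun N : ℕ =>
    (1 / (N : ℝ)) * ∫ ω, ∑ t ∈ range N, (A.w * A.p (π.age t ω) + l * π.occupied t ω) ∂μ) atTop

end Policy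

/-- The optimal value of the decoupled problem with transmission cost `l`, over all causal
policies. -/
noncomputable def optValue (A : Bandit μ) (l : ℝ) : ℝ :=
  ⨅ π : A.Policy, π.averageCost l

/-- The average `(1/τ) ∑_{k < τ} E[w p(δ + k + T)]`. -/
noncomputable def windowAverage (A : Bandit μ) (δ τ : ℕ) : ℝ :=
  (1 / (τ : ℝ)) * ∑ k ∈ range τ, ∫ ω, A.w * A.p (δ + k + A.T 1 ω) ∂μ

/-- The index function `γ(δ)`. -/
noncomputable def gam (A : Bandit μ) (δ : ℕ) : ℝ :=
  ⨅ τ : ℕ+, A.windowAverage δ τ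

/-- Lower long-run average of the weighted error when nothing is ever delivered. -/
noncomputable def agingAverage (A : Bandit μ) : ℝ :=
  liminf (fun n : ℕ => (1 / (n : ℝ)) * ∑ k ∈ range n, A.w * A.p k) atTop

/-- The part of the right-hand side of the average-cost Bellman equation of the semi-Markov
decision problem that depends on the waiting time: at an idle slot with age `δ`, wait `τ` slots,
then submit a feature, and pay `w p(age) - g` per slot until it is delivered. The remaining terms
`l * E[T]` and `min_b E[h(T + b)]` of that equation, `h` the relative value function, do not depend
on `τ`. -/
noncomputable def relativeCost (A : Bandit μ) (g : ℝ) (δ τ : ℕ) : ℝ :=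
  ∫ ω, ∑ k ∈ range (τ + A.T 1 ω), (A.w * A.p (δ + k) - g) ∂μ

/-- The states `(δ, d)` in which the passive action is optimal when the transmission cost is `l`:
either a feature is in service (`d > 0`; service is non-preemptive, so no other action is
available), or the channel is idle and waiting for at least one slot is, in the Bellman equation
whose gain is the optimal value, at least as good as submitting a feature immediately. The infimum
is taken in the extended reals. -/
def passiveSet (A : Bandit μ) (l : ℝ) : Set (ℕ × ℕ) :=
  {s | 0 < s.2 ∨
    (⨅ τ : ℕ+, (A.relativeCost (A.optValue l) s.1 τ : EReal)) ≤
      (A.relativeCost (A.optValue l) s.1 0 : EReal)}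

/-- The Whittle index of the state `(δ, d)`, with `inf ∅ = +∞`. -/
noncomputable def whittleIndex (A : Bandit μ) (δ d : ℕ) : EReal :=
  sInf ((fun l : ℝ => (l : EReal)) '' {l : ℝ | (δ, d) ∈ A.passiveSet l})

/-- Submission slots of the `β`-threshold policy with constant buffer position `b`: after a
delivery, submit in the first slot in which `γ` of the age `t - S i + b` is at least `β`. -/
noncomputable def thresholdS (A : Bandit μ) (b : ℕ) (β : ℝ) : ℕ → Ω → ℕ
  | 0, _ => 0
  | i + 1, ω =>
      sInf {t : ℕ | thresholdS A b β i ω + A.T i ω ≤ t ∧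
        β ≤ A.gam (t - thresholdS A b β i ω + b)}

/-- Delivery slots of the threshold policy. -/
noncomputable def thresholdD (A : Bandit μ) (b : ℕ) (β : ℝ) (i : ℕ) (ω : Ω) : ℕ :=
  A.thresholdS b β i ω + A.T i ω

/-- The `i`-th inter-delivery interval of the threshold policy is meaningful: almost surely the
minimum that defines `S (i + 1)` exists, and the mean length of the interval is finite. -/
def ThresholdFinite (A : Bandit μ) (b : ℕ) (β : ℝ) (i : ℕ) : Prop :=
  (∀ᵐ ω ∂μ, ∃ t : ℕ, A.thresholdD b β i ω ≤ t ∧ β ≤ A.gam (t - A.thresholdS b β i ω + b)) ∧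
  Integrable (fun ω => (A.thresholdD b β (i + 1) ω : ℝ) - A.thresholdD b β i ω) μ

/-- The explicit expression `W_b(δ, 0)`, computed in the `i`-th inter-delivery interval of the
`γ(δ)`-threshold policy with buffer position `b`. -/
noncomputable def bufferIndex (A : Bandit μ) (i b δ : ℕ) : ℝ :=
  (1 / ∫ ω, (A.T 1 ω : ℝ) ∂μ) *
      (∫ ω, ((A.thresholdD b (A.gam δ) (i + 1) ω : ℝ) - A.thresholdD b (A.gam δ) i ω) ∂μ) *
      A.gam δ
    - (1 / ∫ ω, (A.T 1 ω : ℝ) ∂μ) *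
      ∫ ω, ∑ t ∈ Ico (A.thresholdD b (A.gam δ) i ω) (A.thresholdD b (A.gam δ) (i + 1) ω),
        A.w * A.p (t - A.thresholdS b (A.gam δ) i ω + b) ∂μ

end Bandit

/-! Write `g` for `A.gam δ` and `E` for the mean transmission time. Waiting `τ` slots changes the
Bellman cost by `τ` times the difference of the window average and the gain. When the infimum
defining `g` is attained, the idle state is therefore passive exactly when `g ≤ A.optValue l`
(`mem_passiveSet_iff`), and the index is decided by comparing the optimal value with one number.

For that comparison, charge `w p - g` per slot. After a delivery, waiting until `γ` reaches `g` is
the cheapest choice (`relativeCost_thresholdWait_le`), so the least mean cost of a cycle using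
buffer position `b` is `A.optCycleCost g b + l * E`. If this is nonnegative for every `b`, no causal
policy averages below `g` (`Policy.le_averageCost`). If it is negative for some `b`, repeating the
threshold rule with that `b` averages strictly below `g` (`exists_averageCost_lt`). Hence `g ≤
A.optValue l` means that `l` is at least `-A.optCycleCost g b / E` for all `b`, and this quotient is
the `W_b` of the theorem (`bufferIndex_eq`). The comparison needs no solution of the Bellman
equation.

Both bounds are renewal arguments over a finite horizon `N`. The cost of the first `N` slots is a
sum of cycle costs up to the one cycle that straddles the horizon. Its transmission time is split as
at most `M` plus the excess over `M`; summing the excess over all `N` cycles costs `N` times a mean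
excess that is small for large `M`. Independence then allows the cycle costs to be replaced by
conditional means.

For well-definedness, a liminf average above `g` forces the sums of `A.meanError k - g` to grow
linearly (`exists_linear_growth`). So only finitely many windows compete for the infimum, and
waiting times grow at most linearly in the age. -/

namespace Bandit

variable {Ω : Type*} [mΩ : MeasurableSpace Ω] {μ : Measure Ω}

/-! ### Pathwise decomposition of the horizon cost into delivery cycles. -/

namespace Policy

variable {A : Bandit μ} (π : A.Policy)

lemma S_add_T_eq (i : ℕ) (ω : Ω) : π.S i ω + A.T i ω = π.D i ω := rfl

lemma S_lt_D (i : ℕ) (ω : Ω) : π.S i ω < π.D i ω :=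
  Nat.lt_add_of_pos_right (A.one_le_T i ω)

lemma D_le_S (i : ℕ) (ω : Ω) : π.D i ω ≤ π.S (i + 1) ω := π.nonpreemptive i ω

lemma strictMono_D (ω : Ω) : StrictMono (fun i => π.D i ω) :=
  strictMono_nat_of_lt_succ fun i => (π.D_le_S i ω).trans_lt (π.S_lt_D (i + 1) ω)

lemma strictMono_S (ω : Ω) : StrictMono (fun i => π.S i ω) :=
  strictMono_nat_of_lt_succ fun i => (π.S_lt_D i ω).trans_le (π.D_le_S i ω)

lemma lt_D (i : ℕ) (ω : Ω) : i < π.D i ω :=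
  ((π.strictMono_S ω).le_apply (x := i)).trans_lt (π.S_lt_D i ω)

lemma age_eq_of_mem {i t : ℕ} {ω : Ω} (h1 : π.D i ω ≤ t) (h2 : t < π.D (i + 1) ω) :
    π.age t ω = t - π.S i ω + π.b i ω := by
  have h0 : ¬ t < π.D 0 ω := not_lt.2 (((π.strictMono_D ω).monotone (Nat.zero_le i)).trans h1)
  have hi : Nat.findGreatest (fun i => π.D i ω ≤ t) t = i := by
    rw [Nat.findGreatest_eq_iff]
    refine ⟨((π.lt_D i ω).le.trans h1), fun _ => h1, fun n hn _ h => ?_⟩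
    have : π.D (i + 1) ω ≤ π.D n ω := (π.strictMono_D ω).monotone (Nat.succ_le_of_lt hn)
    omega
  simp only [age, if_neg h0, hi]

lemma occupied_eq_of_mem {i t : ℕ} {ω : Ω} (h1 : π.D i ω ≤ t) (h2 : t < π.D (i + 1) ω) :
    π.occupied t ω = if π.S (i + 1) ω ≤ t then 1 else 0 := by
  unfold occupied
  by_cases h : π.S (i + 1) ω ≤ t
  · rw [if_pos h, if_pos ⟨i + 1, h, h2⟩]
  · rw [if_neg h, if_neg]
    rintro ⟨j, hj1, hj2⟩
    rcases Nat.lt_or_ge i j with hij | hij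
    · exact h (((π.strictMono_S ω).monotone hij).trans hj1)
    · have : π.D j ω ≤ π.D i ω := (π.strictMono_D ω).monotone hij
      omega

lemma occupied_nonneg (t : ℕ) (ω : Ω) : 0 ≤ π.occupied t ω := by
  unfold occupied; split_ifs <;> norm_num

lemma occupied_le_one (t : ℕ) (ω : Ω) : π.occupied t ω ≤ 1 := by
  unfold occupied; split_ifs <;> norm_num

lemma abs_cost_le {u : ℕ → ℝ} {U : ℝ} (hu : ∀ n, |u n| ≤ U) (l : ℝ) (t : ℕ) (ω : Ω) :
    |u (π.age t ω) + l * π.occupied t ω| ≤ U + |l| := by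
  refine (abs_add_le _ _).trans (add_le_add (hu _) ?_)
  rw [abs_mul, abs_of_nonneg (π.occupied_nonneg t ω)]
  exact mul_le_of_le_one_right (abs_nonneg l) (π.occupied_le_one t ω)

/-- The waiting time after the `i`-th delivery, truncated at the horizon `N`. -/
def wait (N i : ℕ) (ω : Ω) : ℕ := min (π.S (i + 1) ω) N - π.D i ω

/-- The cost of the `i`-th inter-delivery cycle when the waiting time is truncated at `N`. -/
noncomputable def cycleCost (u : ℕ → ℝ) (l : ℝ) (N i : ℕ) (ω : Ω) : ℝ :=
  ∑ k ∈ range (π.wait N i ω + A.T (i + 1) ω), u (A.T i ω + π.b i ω + k) + l * A.T (i + 1) ω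

/-- Telescoping over delivery slots; `N` cycles suffice because `π.D N ω` exceeds `N`. -/
lemma sum_cost_eq (f : ℕ → ℝ) (N : ℕ) (ω : Ω) :
    ∑ t ∈ range N, f t = ∑ t ∈ range (min (π.D 0 ω) N), f t +
      ∑ i ∈ range N, ∑ t ∈ Ico (min (π.D i ω) N) (min (π.D (i + 1) ω) N), f t := by
  have h1 : ∀ i, ∑ t ∈ Ico (min (π.D i ω) N) (min (π.D (i + 1) ω) N), f t
      = ∑ t ∈ range (min (π.D (i + 1) ω) N), f t - ∑ t ∈ range (min (π.D i ω) N), f t := fun i =>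
    Finset.sum_Ico_eq_sub _ (min_le_min_right _ ((π.strictMono_D ω).monotone (Nat.le_succ i)))
  simp only [h1]
  rw [Finset.sum_range_sub (fun i => ∑ t ∈ range (min (π.D i ω) N), f t),
    min_eq_right (π.lt_D N ω).le]
  ring

lemma abs_sum_range_sub_le {u : ℕ → ℝ} {U : ℝ} (hu : ∀ n, |u n| ≤ U) {m n : ℕ} (h : m ≤ n) :
    |∑ k ∈ range m, u k - ∑ k ∈ range n, u k| ≤ U * ((n : ℝ) - m) := by
  rw [abs_sub_comm, ← Finset.sum_Ico_eq_sub _ h]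
  refine (Finset.abs_sum_le_sum_abs _ _).trans ((Finset.sum_le_sum fun k _ => hu k).trans ?_)
  rw [Finset.sum_const, Nat.card_Ico, nsmul_eq_mul, Nat.cast_sub h, mul_comm]

/-- Since the waiting time in `cycleCost` is already cut at the horizon, only the straddling cycle
differs from its cut version, and by no more slots than its transmission time. -/
lemma abs_cycle_sub_le {u : ℕ → ℝ} {U : ℝ} (hu : ∀ n, |u n| ≤ U) (l : ℝ) (N i : ℕ) (ω : Ω) :
    |∑ t ∈ Ico (min (π.D i ω) N) (min (π.D (i + 1) ω) N), (u (π.age t ω) + l * π.occupied t ω)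
      - (if π.D i ω < N then π.cycleCost u l N i ω else 0)|
      ≤ (U + |l|) * (if π.D i ω < N ∧ N ≤ π.D (i + 1) ω then (A.T (i + 1) ω : ℝ) else 0) := by
  have hDS := π.D_le_S i ω
  have hSD := π.S_lt_D (i + 1) ω
  have hT := π.S_add_T_eq (i + 1) ω
  have hT0 := π.S_add_T_eq i ω
  by_cases hN : π.D i ω < N
  swap
  · have e1 : min (π.D i ω) N = N := min_eq_right (not_lt.1 hN)
    have e2 : min (π.D (i + 1) ω) N = N := min_eq_right (by omega)
    simp [e1, e2, hN]
  have hU : 0 ≤ U := (abs_nonneg _).trans (hu 0)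
  have e1 : min (π.D i ω) N = π.D i ω := min_eq_left hN.le
  set m := min (π.D (i + 1) ω) N with hm
  have hmD : m ≤ π.D (i + 1) ω := min_le_left _ _
  have hDm : π.D i ω ≤ m := by omega
  have s1 : ∑ t ∈ Ico (π.D i ω) m, u (π.age t ω)
      = ∑ k ∈ range (m - π.D i ω), u (A.T i ω + π.b i ω + k) := by
    rw [Finset.sum_Ico_eq_sum_range]
    refine Finset.sum_congr rfl fun k hk => ?_
    rw [mem_range] at hk
    rw [π.age_eq_of_mem (i := i) (by omega) (by omega)]
    congr 1
    omega
  have s2 : ∑ t ∈ Ico (π.D i ω) m, π.occupied t ω = (m : ℝ) - min (π.S (i + 1) ω) m := by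
    rw [Finset.sum_congr rfl (g := fun t => if π.S (i + 1) ω ≤ t then (1 : ℝ) else 0)
      (fun t ht => by
        rw [mem_Ico] at ht
        exact π.occupied_eq_of_mem ht.1 (by omega))]
    rw [← Finset.sum_filter, Finset.sum_const, nsmul_eq_mul, mul_one]
    have : (Ico (π.D i ω) m).filter (fun t => π.S (i + 1) ω ≤ t)
        = Ico (min (π.S (i + 1) ω) m) m := by
      ext t
      simp only [mem_filter, mem_Ico]
      omega
    rw [this, Nat.card_Ico, Nat.cast_sub (min_le_right _ _)]
  rw [e1, Finset.sum_add_distrib, ← Finset.mul_sum, s1, s2, if_pos hN, cycleCost, wait]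
  by_cases hN2 : π.D (i + 1) ω < N
  · have e3 : m = π.D (i + 1) ω := min_eq_left hN2.le
    have e4 : min (π.S (i + 1) ω) N = π.S (i + 1) ω := min_eq_left (by omega)
    have e5 : min (π.S (i + 1) ω) m = π.S (i + 1) ω := min_eq_left (by omega)
    have e6 : π.S (i + 1) ω - π.D i ω + A.T (i + 1) ω = π.D (i + 1) ω - π.D i ω := by omega
    have e7 : ((π.D (i + 1) ω : ℕ) : ℝ) = π.S (i + 1) ω + A.T (i + 1) ω := by
      rw [← hT]; push_cast; rfl
    rw [e5, e4, e6, e3, e7]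
    have hn : ¬ (π.D i ω < N ∧ N ≤ π.D (i + 1) ω) := by omega
    rw [if_neg hn]
    apply le_of_eq
    ring_nf
    simp
  · have hc : π.D i ω < N ∧ N ≤ π.D (i + 1) ω := ⟨hN, not_lt.1 hN2⟩
    have e3 : m = N := min_eq_right hc.2
    rw [if_pos hc, e3]
    have hle : N - π.D i ω ≤ min (π.S (i + 1) ω) N - π.D i ω + A.T (i + 1) ω := by omega
    have b1 := abs_sum_range_sub_le (u := fun k => u (A.T i ω + π.b i ω + k)) (fun _ => hu _) hle
    have hlen : ((min (π.S (i + 1) ω) N - π.D i ω + A.T (i + 1) ω : ℕ) : ℝ)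
        - (N - π.D i ω : ℕ) ≤ A.T (i + 1) ω := by
      rw [sub_le_iff_le_add]
      exact_mod_cast (by omega)
    have b2 : |((N : ℝ) - (min (π.S (i + 1) ω) N : ℕ)) - A.T (i + 1) ω| ≤ A.T (i + 1) ω := by
      have h1 : ((min (π.S (i + 1) ω) N : ℕ) : ℝ) ≤ N := Nat.cast_le.2 (min_le_right _ _)
      have h2 : (N : ℝ) ≤ (min (π.S (i + 1) ω) N : ℕ) + A.T (i + 1) ω := by
        rw [← Nat.cast_add, Nat.cast_le]
        omega
      have h3 : (0 : ℝ) ≤ A.T (i + 1) ω := Nat.cast_nonneg _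
      rw [abs_le]; constructor <;> linarith
    have b3 := mul_le_mul_of_nonneg_left hlen hU
    have b4 := mul_le_mul_of_nonneg_left b2 (abs_nonneg l)
    rw [← abs_mul] at b4
    rw [add_sub_add_comm, ← mul_sub, add_mul]
    exact (abs_add_le _ _).trans (add_le_add (b1.trans b3) b4)

/-- At most one index is the last at which `P` holds, so the part of `X i` below `M` is paid once.
The index is random in the applications, so the excess over `M` is paid at every index; this makes
the bound easy to integrate. -/
lemma sum_indicator_mul_le {P : ℕ → Prop} [DecidablePred P] (hP : ∀ i, P (i + 1) → P i)
    {X : ℕ → ℝ} {M : ℝ} (hM : 0 ≤ M) (N : ℕ) :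
    ∑ i ∈ range N, (if P i ∧ ¬ P (i + 1) then X i else 0)
      ≤ M + ∑ i ∈ range N, max (X i - M) 0 := by
  have h1 : ∀ i, (if P i ∧ ¬ P (i + 1) then X i else 0)
      ≤ M * ((if P i then 1 else 0) - (if P (i + 1) then 1 else 0)) + max (X i - M) 0 := by
    intro i
    have hm := le_max_left (X i - M) 0
    have hm0 := le_max_right (X i - M) 0
    have := hP i
    by_cases h : P i <;> by_cases h' : P (i + 1) <;> simp only [h, h'] <;> simp <;>
      first | linarith | tauto
  refine (Finset.sum_le_sum fun i _ => h1 i).trans ?_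
  rw [Finset.sum_add_distrib, ← Finset.mul_sum]
  gcongr
  have e : ∑ i ∈ range N, ((if P i then (1 : ℝ) else 0) - (if P (i + 1) then 1 else 0))
      = (if P 0 then (1 : ℝ) else 0) - (if P N then 1 else 0) := by
    rw [Finset.sum_range_sub']
  rw [e]
  have : (if P 0 then (1 : ℝ) else 0) - (if P N then 1 else 0) ≤ 1 := by
    split_ifs <;> norm_num
  nlinarith

theorem abs_sum_cost_sub_le {u : ℕ → ℝ} {U : ℝ} (hu : ∀ n, |u n| ≤ U) (l : ℝ) (N : ℕ) (ω : Ω)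
    {M : ℝ} (hM : 0 ≤ M) :
    |∑ t ∈ range N, (u (π.age t ω) + l * π.occupied t ω)
      - ∑ i ∈ range N, (if π.D i ω < N then π.cycleCost u l N i ω else 0)|
      ≤ (U + |l|) * (A.T 0 ω + M + ∑ i ∈ range N, max ((A.T (i + 1) ω : ℝ) - M) 0) := by
  have hU : 0 ≤ U := (abs_nonneg _).trans (hu 0)
  have hUl : 0 ≤ U + |l| := add_nonneg hU (abs_nonneg l)
  rw [π.sum_cost_eq _ N ω, add_sub_assoc, ← Finset.sum_sub_distrib]
  refine (abs_add_le _ _).trans ?_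
  rw [add_assoc, mul_add]
  refine add_le_add ?_ ?_
  · refine (Finset.abs_sum_le_sum_abs _ _).trans
      ((Finset.sum_le_sum fun t _ => π.abs_cost_le hu l t ω).trans ?_)
    rw [Finset.sum_const, card_range, nsmul_eq_mul, mul_comm]
    gcongr
    have := π.S_add_T_eq 0 ω
    rw [π.S_zero] at this
    omega
  · refine (Finset.abs_sum_le_sum_abs _ _).trans ?_
    refine (Finset.sum_le_sum fun i _ => π.abs_cycle_sub_le hu l N i ω).trans ?_
    rw [← Finset.mul_sum]
    gcongr
    have := sum_indicator_mul_le (P := fun i => π.D i ω < N)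
      (fun i h => (π.strictMono_D ω (Nat.lt_succ_self i)).trans h)
      (X := fun i => (A.T (i + 1) ω : ℝ)) hM N
    simpa only [not_lt] using this

end Policy
end Bandit

/-! ### Mean costs of a single cycle and optimal waiting. -/

namespace Bandit

variable {Ω : Type*} [mΩ : MeasurableSpace Ω] {μ : Measure Ω}

lemma exists_abs_cost_sub_le (A : Bandit μ) (g : ℝ) :
    ∃ U : ℝ, 0 ≤ U ∧ ∀ n, |A.w * A.p n - g| ≤ U := by
  obtain ⟨M, hM⟩ := A.p_bounded
  have h : ∀ n, |A.w * A.p n - g| ≤ A.w * M + |g| := fun n => by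
    refine (abs_sub _ _).trans ?_
    rw [abs_mul, abs_of_pos A.w_pos]
    gcongr
    · exact A.w_pos.le
    · exact hM n
  exact ⟨_, (abs_nonneg _).trans (h 0), h⟩

/-! ### The transmission times -/

lemma identDistrib_T (A : Bandit μ) (i j : ℕ) : IdentDistrib (A.T i) (A.T j) μ μ :=
  (A.T_ident i).trans (A.T_ident j).symm

lemma integral_comp_T (A : Bandit μ) (f : ℕ → ℝ) (i j : ℕ) :
    ∫ ω, f (A.T i ω) ∂μ = ∫ ω, f (A.T j ω) ∂μ :=
  ((A.identDistrib_T i j).comp (Measurable.of_discrete (f := f))).integral_eq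

lemma integrable_comp_T_iff (A : Bandit μ) (f : ℕ → ℝ) (i j : ℕ) :
    Integrable (fun ω => f (A.T i ω)) μ ↔ Integrable (fun ω => f (A.T j ω)) μ :=
  ((A.identDistrib_T i j).comp (Measurable.of_discrete (f := f))).integrable_iff

lemma integrable_T (A : Bandit μ) (i : ℕ) : Integrable (fun ω => (A.T i ω : ℝ)) μ :=
  (A.integrable_comp_T_iff (fun n => (n : ℝ)) i 0).2 A.T_integrable

lemma measurable_comp_T (A : Bandit μ) (f : ℕ → ℝ) (i : ℕ) : Measurable fun ω => f (A.T i ω) :=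
  (Measurable.of_discrete (f := f)).comp (A.T_measurable i)

/-- The mean weighted error one transmission time after age `n`. -/
noncomputable def meanError (A : Bandit μ) (n : ℕ) : ℝ := ∫ ω, A.w * A.p (n + A.T 1 ω) ∂μ

lemma windowAverage_eq (A : Bandit μ) (a τ : ℕ) :
    A.windowAverage a τ = (1 / (τ : ℝ)) * ∑ k ∈ range τ, A.meanError (a + k) := rfl

lemma exists_windowAverage_lt (A : Bandit μ) {g : ℝ} {a : ℕ} (h : A.gam a < g) :
    ∃ τ : ℕ, 1 ≤ τ ∧ A.windowAverage a τ < g := by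
  obtain ⟨τ, hτ⟩ := exists_lt_of_ciInf_lt h
  exact ⟨τ, τ.pos, hτ⟩

lemma sum_meanError_sub (A : Bandit μ) (g : ℝ) (a τ : ℕ) :
    ∑ k ∈ range τ, (A.meanError (a + k) - g) = τ * (A.windowAverage a τ - g) := by
  rcases Nat.eq_zero_or_pos τ with rfl | h
  · simp
  · have : (τ : ℝ) ≠ 0 := by positivity
    rw [windowAverage_eq, Finset.sum_sub_distrib]
    simp only [sum_const, card_range, nsmul_eq_mul]
    field_simp

lemma exists_sum_meanError_sub_neg (A : Bandit μ) {g : ℝ} {a : ℕ} (h : A.gam a < g) :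
    ∃ τ : ℕ, 1 ≤ τ ∧ ∑ k ∈ range τ, (A.meanError (a + k) - g) < 0 := by
  obtain ⟨τ, hτ, hlt⟩ := A.exists_windowAverage_lt h
  refine ⟨τ, hτ, ?_⟩
  rw [sum_meanError_sub]
  exact mul_neg_of_pos_of_neg (by positivity) (sub_neg.2 hlt)

variable [IsProbabilityMeasure μ]

lemma one_le_integral_T (A : Bandit μ) : 1 ≤ ∫ ω, (A.T 1 ω : ℝ) ∂μ := by
  have h := integral_mono (μ := μ) (integrable_const (1 : ℝ)) (A.integrable_T 1)
    (fun ω => Nat.one_le_cast.2 (A.one_le_T 1 ω))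
  simpa using h

/-- Freezing lemma: a transmission time that is independent of `X` may be integrated out first. -/
lemma integrable_and_integral_indep (A : Bandit μ) {α : Type*} [MeasurableSpace α]
    [DiscreteMeasurableSpace α] [Countable α] {X : Ω → α} (hX : Measurable X) {i : ℕ}
    (hind : IndepFun X (A.T i) μ) (φ : α → ℕ → ℝ)
    (hint : Integrable (fun ω => φ (X ω) (A.T i ω)) μ) :
    Integrable (fun ω => ∫ ω', φ (X ω) (A.T 1 ω') ∂μ) μ ∧
    ∫ ω, φ (X ω) (A.T i ω) ∂μ = ∫ ω, ∫ ω', φ (X ω) (A.T 1 ω') ∂μ ∂μ := by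
  have hT := A.T_measurable i
  have hmap := (indepFun_iff_map_prod_eq_prod_map_map hX.aemeasurable hT.aemeasurable).1 hind
  have hφ : Measurable (fun x : α × ℕ => φ x.1 x.2) := Measurable.of_discrete
  have hpair : Measurable fun ω => (X ω, A.T i ω) := hX.prodMk hT
  have : IsProbabilityMeasure (μ.map X) := Measure.isProbabilityMeasure_map hX.aemeasurable
  have : IsProbabilityMeasure (μ.map (A.T i)) := Measure.isProbabilityMeasure_map hT.aemeasurable
  have hint' : Integrable (fun x : α × ℕ => φ x.1 x.2) ((μ.map X).prod (μ.map (A.T i))) := by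
    rw [← hmap]
    exact (integrable_map_measure hφ.aestronglyMeasurable hpair.aemeasurable).2 hint
  have inner : ∀ x, ∫ n, φ x n ∂(μ.map (A.T i)) = ∫ ω', φ x (A.T 1 ω') ∂μ := fun x => by
    rw [integral_map hT.aemeasurable Measurable.of_discrete.aestronglyMeasurable]
    exact A.integral_comp_T (φ x) i 1
  constructor
  · have h1 := hint'.integral_prod_left
    simp only [inner] at h1
    exact (integrable_map_measure Measurable.of_discrete.aestronglyMeasurable hX.aemeasurable).1 h1
  · calc ∫ ω, φ (X ω) (A.T i ω) ∂μ
        = ∫ x, φ x.1 x.2 ∂(μ.map fun ω => (X ω, A.T i ω)) :=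
          (integral_map hpair.aemeasurable hφ.aestronglyMeasurable).symm
      _ = ∫ x, ∫ n, φ x n ∂(μ.map (A.T i)) ∂(μ.map X) := by
          rw [hmap, integral_prod _ hint']
      _ = _ := by
          simp only [inner]
          exact integral_map hX.aemeasurable Measurable.of_discrete.aestronglyMeasurable

/-! ### The Bellman cost of a waiting time -/

lemma abs_sum_range_le {u : ℕ → ℝ} {U : ℝ} (hu : ∀ n, |u n| ≤ U) (n : ℕ) :
    |∑ k ∈ range n, u k| ≤ U * n := by
  have := Policy.abs_sum_range_sub_le hu (Nat.zero_le n)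
  rw [abs_sub_comm] at this
  simpa using this

lemma integrable_sum_range (A : Bandit μ) (g : ℝ) (a z i : ℕ) :
    Integrable (fun ω => ∑ k ∈ range (z + A.T i ω), (A.w * A.p (a + k) - g)) μ := by
  obtain ⟨U, hU, hu⟩ := A.exists_abs_cost_sub_le g
  refine (((integrable_const (z : ℝ)).add (A.integrable_T i)).const_mul U).mono'
    (A.measurable_comp_T
      (fun n => ∑ k ∈ range (z + n), (A.w * A.p (a + k) - g)) i).aestronglyMeasurable
    (ae_of_all _ fun ω => ?_)
  have := abs_sum_range_le (u := fun k => A.w * A.p (a + k) - g) (fun _ => hu _) (z + A.T i ω)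
  simpa using this

lemma abs_relativeCost_le (A : Bandit μ) {g U : ℝ} (hu : ∀ n, |A.w * A.p n - g| ≤ U) (a z : ℕ) :
    |A.relativeCost g a z| ≤ U * (z + ∫ ω, (A.T 1 ω : ℝ) ∂μ) := by
  have hI : Integrable (fun ω => U * ((z : ℝ) + A.T 1 ω)) μ :=
    ((integrable_const (z : ℝ)).add (A.integrable_T 1)).const_mul U
  have := norm_integral_le_of_norm_le
    (f := fun ω => ∑ k ∈ range (z + A.T 1 ω), (A.w * A.p (a + k) - g)) hI (ae_of_all _ fun ω => by
    have := abs_sum_range_le (u := fun k => A.w * A.p (a + k) - g) (fun _ => hu _) (z + A.T 1 ω)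
    push_cast at this
    exact this)
  rw [integral_const_mul, integral_add (integrable_const _) (A.integrable_T 1)] at this
  simp only [integral_const, probReal_univ, one_smul] at this
  exact this

lemma integrable_error (A : Bandit μ) (n i : ℕ) :
    Integrable (fun ω => A.w * A.p (n + A.T i ω)) μ := by
  obtain ⟨U, hU, hu⟩ := A.exists_abs_cost_sub_le 0
  simp only [sub_zero] at hu
  exact (integrable_const U).mono'
    (A.measurable_comp_T (fun m => A.w * A.p (n + m)) i).aestronglyMeasurable
    (ae_of_all _ fun ω => hu _)

lemma abs_meanError_sub_le (A : Bandit μ) {g U : ℝ} (hu : ∀ n, |A.w * A.p n - g| ≤ U) (n : ℕ) :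
    |A.meanError n - g| ≤ U := by
  have h : A.meanError n - g = ∫ ω, (A.w * A.p (n + A.T 1 ω) - g) ∂μ := by
    rw [integral_sub (A.integrable_error n 1) (integrable_const g)]
    simp [meanError]
  rw [h]
  have := norm_integral_le_of_norm_le (μ := μ) (f := fun ω => A.w * A.p (n + A.T 1 ω) - g)
    (integrable_const U) (ae_of_all _ fun ω => hu (n + A.T 1 ω))
  simpa using this

/-- Read the `z + T` slots as `T` slots followed by `z` more: the `k`-th extra slot has age `a + k +
T`, whose mean error is `A.meanError (a + k)`. Waiting costs thus become deterministic partial sums.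
-/
lemma relativeCost_add (A : Bandit μ) (g : ℝ) (a z : ℕ) :
    A.relativeCost g a z = A.relativeCost g a 0 + ∑ k ∈ range z, (A.meanError (a + k) - g) := by
  have h : ∀ k, A.meanError (a + k) - g = ∫ ω, (A.w * A.p (a + k + A.T 1 ω) - g) ∂μ := fun k => by
    rw [integral_sub (A.integrable_error (a + k) 1) (integrable_const g)]
    simp [meanError]
  have hI : ∀ k, Integrable (fun ω => A.w * A.p (a + k + A.T 1 ω) - g) μ := fun k =>
    (A.integrable_error (a + k) 1).sub (integrable_const g)
  simp only [h, relativeCost]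
  rw [← integral_finsetSum _ fun k _ => hI k, ← integral_add (A.integrable_sum_range g a 0 1)
      (integrable_finsetSum _ fun k _ => hI k)]
  refine integral_congr_ae (ae_of_all _ fun ω => ?_)
  simp only
  rw [add_comm z, Finset.sum_range_add, zero_add]
  congr 1
  refine Finset.sum_congr rfl fun k _ => ?_
  rw [add_assoc, add_comm k]

lemma windowAverage_bddBelow (A : Bandit μ) (a : ℕ) :
    BddBelow (Set.range fun τ : ℕ+ => A.windowAverage a τ) := by
  obtain ⟨U, hU, hu⟩ := A.exists_abs_cost_sub_le 0
  refine ⟨-U, ?_⟩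
  rintro _ ⟨τ, rfl⟩
  have h := abs_sum_range_le (u := fun k => A.meanError (a + k))
    (fun n => by simpa using A.abs_meanError_sub_le hu (a + n)) τ
  have hτ : (0 : ℝ) < (τ : ℕ) := by exact_mod_cast τ.pos
  simp only [windowAverage_eq]
  rw [one_div, inv_mul_eq_div, le_div_iff₀ hτ]
  linarith [(abs_le.1 h).1]

lemma gam_le_windowAverage (A : Bandit μ) (a : ℕ) {τ : ℕ} (hτ : 1 ≤ τ) :
    A.gam a ≤ A.windowAverage a τ :=
  ciInf_le (A.windowAverage_bddBelow a) (⟨τ, hτ⟩ : ℕ+)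

lemma sum_meanError_sub_nonneg (A : Bandit μ) {g : ℝ} {a : ℕ} (h : g ≤ A.gam a) (τ : ℕ) :
    0 ≤ ∑ k ∈ range τ, (A.meanError (a + k) - g) := by
  rw [sum_meanError_sub]
  rcases Nat.eq_zero_or_pos τ with rfl | hτ
  · simp
  · exact mul_nonneg (Nat.cast_nonneg _) (sub_nonneg.2 (h.trans (A.gam_le_windowAverage a hτ)))

/-- The waiting time of the `g`-threshold policy after a delivery that resets the age to `a`. -/
noncomputable def thresholdWait (A : Bandit μ) (g : ℝ) (a : ℕ) : ℕ := sInf {z | g ≤ A.gam (a + z)}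

/-- Waiting until `γ` reaches `g` is an optimal stopping rule. -/
lemma relativeCost_thresholdWait_le (A : Bandit μ) {g : ℝ} {a : ℕ}
    (h : ∃ z, g ≤ A.gam (a + z)) (z : ℕ) :
    A.relativeCost g a (A.thresholdWait g a) ≤ A.relativeCost g a z := by
  rw [relativeCost_add A g a z, relativeCost_add A g a (A.thresholdWait g a)]
  gcongr 1
  have hs : g ≤ A.gam (a + A.thresholdWait g a) := Nat.sInf_mem (s := {z | g ≤ A.gam (a + z)}) h
  have split : ∀ m n, ∑ k ∈ range (m + n), (A.meanError (a + k) - g)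
      = ∑ k ∈ range m, (A.meanError (a + k) - g)
        + ∑ k ∈ range n, (A.meanError (a + m + k) - g) := fun m n => by
    rw [Finset.sum_range_add]
    simp only [add_assoc]
  -- Before the threshold some window has average below `g`, so waiting through it lowers the cost
  -- and brings `z` nearer to, or past, the threshold. From the threshold on, every further window
  -- has nonnegative cost.
  induction hd : A.thresholdWait g a - z using Nat.strong_induction_on generalizing z with
  | _ d ih =>
    rcases Nat.lt_or_ge z (A.thresholdWait g a) with hz | hz
    · have hlt : A.gam (a + z) < g := not_le.1 (Nat.notMem_of_lt_sInf hz)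
      obtain ⟨τ, hτ, hneg⟩ := A.exists_sum_meanError_sub_neg hlt
      have h1 := ih _ (by omega) (z + τ) rfl
      rw [split z τ] at h1
      linarith
    · obtain ⟨n, rfl⟩ := Nat.exists_eq_add_of_le hz
      rw [split]
      linarith [A.sum_meanError_sub_nonneg hs n]

end Bandit

namespace Bandit

variable {Ω : Type*} [mΩ : MeasurableSpace Ω] {μ : Measure Ω}

/-! ### Measurability of policies and conditional means of cycle costs. -/

namespace Policy

variable {A : Bandit μ} (π : A.Policy)

lemma measurable_S (i : ℕ) : Measurable (π.S i) := (π.S_measurable i).mono (π.info.le i) le_rfl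

lemma measurable_b (i : ℕ) : Measurable (π.b i) := (π.b_measurable i).mono (π.info.le i) le_rfl

lemma measurable_D (i : ℕ) : Measurable (π.D i) := (π.measurable_S i).add (A.T_measurable i)

lemma _root_.Measurable.select_nat {f : ℕ → Ω → ℕ} (hf : ∀ n, Measurable (f n)) {j : Ω → ℕ}
    (hj : Measurable j) : Measurable fun ω => f (j ω) ω :=
  (measurable_from_prod_countable_right (f := fun p : ℕ × Ω => f p.1 p.2) hf).comp
    (hj.prodMk measurable_id)

lemma measurable_age (t : ℕ) : Measurable (π.age t) := by
  have hj : Measurable fun ω => Nat.findGreatest (fun i => π.D i ω ≤ t) t :=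
    measurable_findGreatest fun k _ => measurableSet_le (π.measurable_D k) measurable_const
  unfold age
  refine Measurable.ite (measurableSet_lt measurable_const (π.measurable_D 0)) measurable_const ?_
  exact (measurable_const.sub (Measurable.select_nat π.measurable_S hj)).add
    (Measurable.select_nat π.measurable_b hj)

lemma measurable_occupied (t : ℕ) : Measurable (π.occupied t) := by
  unfold occupied
  refine Measurable.ite ?_ measurable_const measurable_const
  have : {ω | ∃ i, π.S i ω ≤ t ∧ t < π.D i ω} = ⋃ i, {ω | π.S i ω ≤ t ∧ t < π.D i ω} := by
    ext ω; simp
  rw [this]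
  exact MeasurableSet.iUnion fun i =>
    (measurableSet_le (π.measurable_S i) measurable_const).inter
      (measurableSet_lt measurable_const (π.measurable_D i))

lemma measurable_cost (u : ℕ → ℝ) (l : ℝ) (t : ℕ) :
    Measurable fun ω => u (π.age t ω) + l * π.occupied t ω :=
  ((Measurable.of_discrete (f := u)).comp (π.measurable_age t)).add
    ((π.measurable_occupied t).const_mul l)

/-- The delivery slot, the age at delivery and the truncated waiting time of cycle `i`. -/
def cycleState (N i : ℕ) (ω : Ω) : ℕ × ℕ × ℕ :=
  (π.D i ω, A.T i ω + π.b i ω, π.wait N i ω)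

lemma measurable_info_cycleState (N i : ℕ) :
    Measurable[π.info (i + 1)] (π.cycleState N i) := by
  have hle : π.info i ≤ π.info (i + 1) := π.info.mono (Nat.le_succ i)
  have hS := (π.S_measurable i).mono hle le_rfl
  have hb := (π.b_measurable i).mono hle le_rfl
  have hT := π.T_observed i
  have hS' := π.S_measurable (i + 1)
  have hD : Measurable[π.info (i + 1)] (π.D i) := Measurable.add hS hT
  exact hD.prodMk ((Measurable.add hT hb).prodMk
    (Measurable.sub (Measurable.min hS' measurable_const) hD))

lemma indepFun_of_info {α : Type*} [MeasurableSpace α] {X : Ω → α} {i : ℕ}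
    (hX : Measurable[π.info i] X) : IndepFun X (A.T i) μ := by
  rw [IndepFun_iff_Indep]
  exact indep_of_indep_of_le_left (π.T_indep_info i) hX.comap_le

/-- The expected cost per slot over the first `N` slots. -/
noncomputable def meanCost (l : ℝ) (N : ℕ) : ℝ :=
  (1 / (N : ℝ)) * ∫ ω, ∑ t ∈ range N, (A.w * A.p (π.age t ω) + l * π.occupied t ω) ∂μ

variable [IsProbabilityMeasure μ]

lemma integrable_cost {u : ℕ → ℝ} {U : ℝ} (hu : ∀ n, |u n| ≤ U) (l : ℝ) (t : ℕ) :
    Integrable (fun ω => u (π.age t ω) + l * π.occupied t ω) μ :=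
  (integrable_const (U + |l|)).mono' (π.measurable_cost u l t).aestronglyMeasurable
    (ae_of_all _ fun ω => π.abs_cost_le hu l t ω)

/-- The conditional mean of the cost of the `i`-th cycle, on the event that it begins before `N`. -/
noncomputable def cycleMean (g l : ℝ) (N i : ℕ) (ω : Ω) : ℝ :=
  if π.D i ω < N then
    A.relativeCost g (A.T i ω + π.b i ω) (π.wait N i ω) + l * ∫ ω', (A.T 1 ω' : ℝ) ∂μ
  else 0

/-- The start, age and waiting time of cycle `i` are known when feature `i + 1` is submitted, so
`A.T (i + 1)` can be integrated out. Truncating the wait at `N` gives integrability for policies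
whose waiting times have no finite mean. -/
lemma integral_cycleCost (g l : ℝ) (N i : ℕ) :
    Integrable (fun ω => if π.D i ω < N then
      π.cycleCost (fun n => A.w * A.p n - g) l N i ω else 0) μ ∧
    Integrable (π.cycleMean g l N i) μ ∧
    ∫ ω, (if π.D i ω < N then π.cycleCost (fun n => A.w * A.p n - g) l N i ω else 0) ∂μ
      = ∫ ω, π.cycleMean g l N i ω ∂μ := by
  obtain ⟨U, hU, hu⟩ := A.exists_abs_cost_sub_le g
  let φ : ℕ × ℕ × ℕ → ℕ → ℝ := fun x n =>
    if x.1 < N then ∑ k ∈ range (x.2.2 + n), (A.w * A.p (x.2.1 + k) - g) + l * n else 0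
  have hXi := π.measurable_info_cycleState N i
  have hX : Measurable (π.cycleState N i) := hXi.mono (π.info.le _) le_rfl
  have hφ : Measurable fun ω => φ (π.cycleState N i ω) (A.T (i + 1) ω) :=
    (Measurable.of_discrete (f := fun x : (ℕ × ℕ × ℕ) × ℕ => φ x.1 x.2)).comp
      (hX.prodMk (A.T_measurable (i + 1)))
  have hint : Integrable (fun ω => φ (π.cycleState N i ω) (A.T (i + 1) ω)) μ := by
    refine ((integrable_const (U * N)).add ((A.integrable_T (i + 1)).const_mul (U + |l|))).mono'
      hφ.aestronglyMeasurable (ae_of_all _ fun ω => ?_)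
    simp only [φ, cycleState, Pi.add_apply, Real.norm_eq_abs]
    split_ifs with h
    · refine (abs_add_le _ _).trans ?_
      have h1 := abs_sum_range_le (u := fun k => A.w * A.p (A.T i ω + π.b i ω + k) - g)
        (fun _ => hu _) (π.wait N i ω + A.T (i + 1) ω)
      have h2 : (π.wait N i ω : ℝ) ≤ N :=
        Nat.cast_le.2 ((Nat.sub_le _ _).trans (min_le_right _ _))
      rw [abs_mul, Nat.abs_cast]
      push_cast at h1
      nlinarith
    · rw [abs_zero]
      positivity
  have key := A.integrable_and_integral_indep hX (π.indepFun_of_info hXi) φ hint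
  have hmean : (fun ω => ∫ ω', φ (π.cycleState N i ω) (A.T 1 ω') ∂μ) = π.cycleMean g l N i := by
    funext ω
    simp only [φ, cycleState, cycleMean]
    split_ifs with h
    · rw [integral_add (A.integrable_sum_range g _ _ 1) ((A.integrable_T 1).const_mul l),
        integral_const_mul]
      rfl
    · simp
  rw [hmean] at key
  exact ⟨hint, key.1, key.2⟩

end Policy

/-- The mean excess of a transmission time over `M`. -/
noncomputable def meanExcess (μ : Measure Ω) (X : Ω → ℝ) (M : ℝ) : ℝ := ∫ ω, max (X ω - M) 0 ∂μ

variable [IsProbabilityMeasure μ]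

lemma integrable_excess {X : Ω → ℝ} (hX : Integrable X μ) (M : ℝ) :
    Integrable (fun ω => max (X ω - M) 0) μ :=
  (hX.sub (integrable_const M)).sup (integrable_zero _ _ _)

lemma exists_meanExcess_lt {X : Ω → ℝ} (hX : Integrable X μ) {ε : ℝ} (hε : 0 < ε) :
    ∃ M : ℝ, 0 ≤ M ∧ meanExcess μ X M < ε := by
  have h : Tendsto (fun n : ℕ => ∫ ω, max (X ω - n) 0 ∂μ) atTop (nhds (∫ _, (0 : ℝ) ∂μ)) := by
    refine tendsto_integral_of_dominated_convergence (fun ω => |X ω|)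
      (fun n => (integrable_excess hX n).aestronglyMeasurable) hX.abs
      (fun n => ae_of_all _ fun ω => ?_) (ae_of_all _ fun ω => ?_)
    · rw [Real.norm_eq_abs, abs_of_nonneg (le_max_right _ _)]
      have : (0 : ℝ) ≤ n := Nat.cast_nonneg n
      exact max_le (by linarith [le_abs_self (X ω)]) (abs_nonneg _)
    · obtain ⟨n₀, hn₀⟩ := exists_nat_ge (X ω)
      refine tendsto_const_nhds.congr' ?_
      filter_upwards [eventually_ge_atTop n₀] with n hn
      have : (n₀ : ℝ) ≤ n := Nat.cast_le.2 hn
      rw [max_eq_right (by linarith)]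
  rw [integral_zero] at h
  obtain ⟨n, hn⟩ := (h.eventually_lt_const hε).exists
  exact ⟨n, Nat.cast_nonneg n, hn⟩

/-! ### Horizon averages in terms of conditional cycle means. -/

namespace Policy

variable {A : Bandit μ} (π : A.Policy)

/-- The level `M` stays free: fixing it large first makes the coefficient of `N` small, and the
remaining terms vanish after division by `N`. -/
theorem abs_integral_cost_sub_le {g U : ℝ} (hu : ∀ n, |A.w * A.p n - g| ≤ U) (l : ℝ) (N : ℕ)
    {M : ℝ} (hM : 0 ≤ M) :
    |∫ ω, ∑ t ∈ range N, (A.w * A.p (π.age t ω) - g + l * π.occupied t ω) ∂μ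
      - ∫ ω, ∑ i ∈ range N, π.cycleMean g l N i ω ∂μ|
      ≤ (U + |l|) * (∫ ω, (A.T 1 ω : ℝ) ∂μ + M
          + N * meanExcess μ (fun ω => (A.T 1 ω : ℝ)) M) := by
  have hE : ∀ i, ∫ ω, max ((A.T i ω : ℝ) - M) 0 ∂μ = meanExcess μ (fun ω => (A.T 1 ω : ℝ)) M :=
    fun i => A.integral_comp_T (fun n => max ((n : ℝ) - M) 0) i 1
  have hI : ∀ i, Integrable (fun ω => max ((A.T i ω : ℝ) - M) 0) μ := fun i =>
    integrable_excess (A.integrable_T i) M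
  have hc := fun i => π.integral_cycleCost g l N i
  have h0 : ∫ ω, (A.T 0 ω : ℝ) ∂μ = ∫ ω, (A.T 1 ω : ℝ) ∂μ :=
    A.integral_comp_T (fun n => (n : ℝ)) 0 1
  rw [integral_finsetSum _ fun i _ => (hc i).2.1,
    ← Finset.sum_congr rfl fun i _ => (hc i).2.2, ← integral_finsetSum _ fun i _ => (hc i).1,
    ← integral_sub (integrable_finsetSum _ fun t _ =>
        π.integrable_cost (u := fun n => A.w * A.p n - g) hu l t)
      (integrable_finsetSum _ fun i _ => (hc i).1)]
  have hb : Integrable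
      (fun ω => (A.T 0 ω + M + ∑ i ∈ range N, max ((A.T (i + 1) ω : ℝ) - M) 0)) μ :=
    ((A.integrable_T 0).add (integrable_const M)).add (integrable_finsetSum _ fun i _ => hI (i + 1))
  have key := norm_integral_le_of_norm_le
    (f := fun ω => ∑ t ∈ range N, (A.w * A.p (π.age t ω) - g + l * π.occupied t ω)
      - ∑ i ∈ range N, (if π.D i ω < N then
          π.cycleCost (fun n => A.w * A.p n - g) l N i ω else 0))
    (hb.const_mul (U + |l|)) (ae_of_all _ fun ω =>
      π.abs_sum_cost_sub_le (u := fun n => A.w * A.p n - g) hu l N ω hM)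
  refine key.trans (le_of_eq ?_)
  have h0M : Integrable (fun ω => (A.T 0 ω : ℝ) + M) μ :=
    (A.integrable_T 0).add (integrable_const M)
  rw [integral_const_mul, integral_add h0M
    (integrable_finsetSum _ fun i _ => hI (i + 1)), integral_add (A.integrable_T 0)
    (integrable_const M), integral_finsetSum _ fun i _ => hI (i + 1)]
  simp [hE, h0]

lemma meanCost_eq (g l : ℝ) {N : ℕ} (hN : 0 < N) :
    π.meanCost l N = g + (1 / (N : ℝ)) *
      ∫ ω, ∑ t ∈ range N, (A.w * A.p (π.age t ω) - g + l * π.occupied t ω) ∂μ := by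
  obtain ⟨U, hU, hu⟩ := A.exists_abs_cost_sub_le g
  have hI : Integrable
      (fun ω => ∑ t ∈ range N, (A.w * A.p (π.age t ω) - g + l * π.occupied t ω)) μ :=
    integrable_finsetSum _ fun t _ => π.integrable_cost (u := fun n => A.w * A.p n - g) hu l t
  have e : ∀ ω, ∑ t ∈ range N, (A.w * A.p (π.age t ω) + l * π.occupied t ω)
      = ∑ t ∈ range N, (A.w * A.p (π.age t ω) - g + l * π.occupied t ω) + N * g := fun ω => by
    have h : (N : ℝ) * g = ∑ _t ∈ range N, g := by simp
    rw [h, ← Finset.sum_add_distrib]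
    exact Finset.sum_congr rfl fun t _ => by ring
  have hN' : (N : ℝ) ≠ 0 := by positivity
  simp only [meanCost, e]
  rw [integral_add hI (integrable_const _)]
  simp only [integral_const, probReal_univ, one_smul]
  field_simp
  ring

lemma abs_meanCost_le {U : ℝ} (hu : ∀ n, |A.w * A.p n - 0| ≤ U) (l : ℝ) (N : ℕ) :
    |π.meanCost l N| ≤ U + |l| := by
  simp only [sub_zero] at hu
  have hU : 0 ≤ U := (abs_nonneg _).trans (hu 0)
  have key := norm_integral_le_of_norm_le (μ := μ) (integrable_const (N * (U + |l|)))
    (f := fun ω => ∑ t ∈ range N, (A.w * A.p (π.age t ω) + l * π.occupied t ω))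
    (ae_of_all _ fun ω => by
      refine (Finset.abs_sum_le_sum_abs _ _).trans ((Finset.sum_le_sum fun t _ =>
        π.abs_cost_le (u := fun n => A.w * A.p n) hu l t ω).trans ?_)
      rw [sum_const, card_range, nsmul_eq_mul])
  simp only [integral_const, probReal_univ, one_smul, Real.norm_eq_abs] at key
  rw [meanCost, abs_mul, abs_of_nonneg (by positivity)]
  rcases Nat.eq_zero_or_pos N with rfl | hN
  · simp; positivity
  · rw [one_div, inv_mul_le_iff₀ (by positivity)]
    exact key

lemma averageCost_ge_of_eventually {l c : ℝ} (h : ∀ᶠ N in atTop, c ≤ π.meanCost l N) :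
    c ≤ π.averageCost l := by
  obtain ⟨U, hU, hu⟩ := A.exists_abs_cost_sub_le 0
  exact le_limsup_of_frequently_le h.frequently
    (isBoundedUnder_of ⟨U + |l|, fun N => (abs_le.1 (π.abs_meanCost_le hu l N)).2⟩)

lemma averageCost_le_of_eventually {l c : ℝ} (h : ∀ᶠ N in atTop, π.meanCost l N ≤ c) :
    π.averageCost l ≤ c := by
  obtain ⟨U, hU, hu⟩ := A.exists_abs_cost_sub_le 0
  exact limsup_le_of_le (IsBoundedUnder.isCoboundedUnder_le
    (isBoundedUnder_of ⟨-(U + |l|), fun N => (abs_le.1 (π.abs_meanCost_le hu l N)).1⟩)) h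

end Policy

lemma bddBelow_averageCost (A : Bandit μ) (l : ℝ) :
    BddBelow (Set.range fun π : A.Policy => π.averageCost l) := by
  obtain ⟨U, hU, hu⟩ := A.exists_abs_cost_sub_le 0
  refine ⟨-(U + |l|), ?_⟩
  rintro _ ⟨π, rfl⟩
  exact π.averageCost_ge_of_eventually
    (Eventually.of_forall fun N => (abs_le.1 (π.abs_meanCost_le hu l N)).1)

end Bandit

/-! ### Optimal cycle costs, and comparison of the optimal value with a given gain. -/

namespace Bandit

variable {Ω : Type*} [mΩ : MeasurableSpace Ω] {μ : Measure Ω}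

/-- The least Bellman cost of a waiting time after a delivery that resets the age to `a`. -/
noncomputable def optCost (A : Bandit μ) (g : ℝ) (a : ℕ) : ℝ :=
  A.relativeCost g a (A.thresholdWait g a)

/-- The optimal mean relative cost of a cycle (without the transmission cost) when the feature
in buffer position `b` is submitted. -/
noncomputable def optCycleCost (A : Bandit μ) (g : ℝ) (b : ℕ) : ℝ :=
  ∫ ω, A.optCost g (A.T 1 ω + b) ∂μ

/-! ### Policies that wait for a function of the last transmission time -/

/-- Submission slots when the waiting time after a transmission time `n` is `W n`. -/
def waitS (A : Bandit μ) (W : ℕ → ℕ) : ℕ → Ω → ℕ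
  | 0, _ => 0
  | i + 1, ω => waitS A W i ω + A.T i ω + W (A.T i ω)

/-- The σ-algebra of the first `i` transmission times. -/
def pastT (A : Bandit μ) : Filtration ℕ mΩ where
  seq i := ⨆ j ∈ {j | j < i}, MeasurableSpace.comap (A.T j) ⊤
  mono' _ _ h := biSup_mono fun _ hj => lt_of_lt_of_le hj h
  le' _ := iSup₂_le fun j _ => (A.T_measurable j).comap_le

lemma measurable_T_pastT (A : Bandit μ) {i j : ℕ} (h : j < i) : Measurable[A.pastT i] (A.T j) := by
  have : MeasurableSpace.comap (A.T j) ⊤ ≤ A.pastT i :=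
    le_biSup (fun j => MeasurableSpace.comap (A.T j) ⊤) (show j ∈ {j | j < i} from h)
  exact Measurable.mono (comap_measurable (A.T j)) this le_rfl

lemma measurable_waitS (A : Bandit μ) (W : ℕ → ℕ) : ∀ i, Measurable[A.pastT i] (A.waitS W i)
  | 0 => measurable_const
  | i + 1 => by
    have h1 := (A.measurable_waitS W i).mono (A.pastT.mono (Nat.le_succ i)) le_rfl
    have h2 := A.measurable_T_pastT (Nat.lt_succ_self i)
    exact Measurable.add (Measurable.add h1 h2) (Measurable.of_discrete.comp h2)

/-- The policy that submits from buffer position `b` and waits for `W n` slots after a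
transmission time `n`. -/
def waitPolicy (A : Bandit μ) (W : ℕ → ℕ) (b : ℕ) (hb : b < A.B) : A.Policy where
  info := A.pastT
  S := A.waitS W
  b _ _ := b
  S_measurable := A.measurable_waitS W
  b_measurable _ := measurable_const
  T_observed i := A.measurable_T_pastT (Nat.lt_succ_self i)
  T_indep_info i := by
    have := indep_iSup_of_disjoint (fun j => (A.T_measurable j).comap_le) A.T_indep
      (S := {j | j < i}) (T := {i}) (by simp)
    rw [_root_.iSup_singleton] at this
    exact this
  S_zero _ := rfl
  nonpreemptive _ _ := Nat.le_add_right _ _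
  b_lt _ _ := hb

instance (A : Bandit μ) : Nonempty A.Policy := ⟨A.waitPolicy (fun _ => 0) 0 A.B_pos⟩

namespace Policy

/-- The submission intervals that begin before `N` cover the first `N` slots. -/
lemma le_sum_cycle_length {A : Bandit μ} (π : A.Policy) (N : ℕ) (ω : Ω) :
    (N : ℝ) ≤ ∑ i ∈ range N,
      (if π.S i ω < N then ((π.S (i + 1) ω : ℝ) - π.S i ω) else 0) := by
  have h : ∀ n, ((min (π.S n ω) N : ℕ) : ℝ) ≤ ∑ i ∈ range n,
      (if π.S i ω < N then ((π.S (i + 1) ω : ℝ) - π.S i ω) else 0) := by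
    intro n
    induction n with
    | zero => simp [π.S_zero]
    | succ n ih =>
      rw [Finset.sum_range_succ]
      refine le_trans ?_ (add_le_add_left ih _)
      split_ifs with hn
      · rw [min_eq_left hn.le]
        push_cast
        linarith [min_le_left (π.S (n + 1) ω : ℝ) N]
      · rw [add_zero, Nat.cast_le]
        omega
  have h1 := h N
  rwa [min_eq_right ((π.strictMono_S ω).le_apply (x := N))] at h1

end Policy

variable [IsProbabilityMeasure μ]

lemma abs_optCost_le (A : Bandit μ) {g U : ℝ} (hu : ∀ n, |A.w * A.p n - g| ≤ U) (a : ℕ) :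
    |A.optCost g a| ≤ U * (A.thresholdWait g a + ∫ ω, (A.T 1 ω : ℝ) ∂μ) :=
  A.abs_relativeCost_le hu a _

lemma integrable_optCost (A : Bandit μ) {g : ℝ} {b i : ℕ}
    (h : Integrable (fun ω => (A.thresholdWait g (A.T 1 ω + b) : ℝ)) μ) :
    Integrable (fun ω => A.optCost g (A.T i ω + b)) μ := by
  obtain ⟨U, hU, hu⟩ := A.exists_abs_cost_sub_le g
  have h' := (A.integrable_comp_T_iff (fun n => (A.thresholdWait g (n + b) : ℝ)) i 1).2 h
  exact ((h'.add (integrable_const _)).const_mul U).mono'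
    (A.measurable_comp_T (fun n => A.optCost g (n + b)) i).aestronglyMeasurable
    (ae_of_all _ fun ω => A.abs_optCost_le hu _)

/-! ### Lower bound for every policy -/

namespace Policy

variable {A : Bandit μ} (π : A.Policy)

theorem neg_le_integral_sum_cycleMean {g l U : ℝ} (hu : ∀ n, |A.w * A.p n - g| ≤ U)
    (hgood : ∀ b < A.B, ∀ᵐ ω ∂μ, ∃ z, g ≤ A.gam (A.T 1 ω + b + z))
    (hint : ∀ b < A.B, Integrable (fun ω => (A.thresholdWait g (A.T 1 ω + b) : ℝ)) μ)
    (hF : ∀ b < A.B, 0 ≤ A.optCycleCost g b + l * ∫ ω, (A.T 1 ω : ℝ) ∂μ) (N : ℕ) :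
    -((U + |l|) * ∫ ω, (A.T 1 ω : ℝ) ∂μ) ≤ ∫ ω, ∑ i ∈ range N, π.cycleMean g l N i ω ∂μ := by
  set E := ∫ ω, (A.T 1 ω : ℝ) ∂μ with hE
  have hE1 : 1 ≤ E := A.one_le_integral_T
  have hU : 0 ≤ U := (abs_nonneg _).trans (hu 0)
  have hC : 0 ≤ (U + |l|) * E := by positivity
  -- The cutoff is on the submission slot rather than the delivery slot: the latter depends on `A.T
  -- i`, while `S i` and `b i` are independent of it. Integrating out `A.T i` then produces exactly
  -- the quantity in `hF`.
  let φ : ℕ × ℕ → ℕ → ℝ := fun x n => if x.1 < N then A.optCost g (n + x.2) + l * E else 0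
  have hXi : ∀ i, Measurable[π.info i] fun ω => (π.S i ω, π.b i ω) := fun i =>
    (π.S_measurable i).prodMk (π.b_measurable i)
  have hX : ∀ i, Measurable fun ω => (π.S i ω, π.b i ω) := fun i =>
    (hXi i).mono (π.info.le _) le_rfl
  have hφi : ∀ i, Integrable (fun ω => φ (π.S i ω, π.b i ω) (A.T i ω)) μ := by
    intro i
    have hm : Measurable fun ω => φ (π.S i ω, π.b i ω) (A.T i ω) :=
      (Measurable.of_discrete (f := fun x : (ℕ × ℕ) × ℕ => φ x.1 x.2)).comp
        ((hX i).prodMk (A.T_measurable i))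
    have hI : Integrable (fun ω => ∑ b ∈ range A.B, |A.optCost g (A.T i ω + b)| + |l * E|) μ :=
      (integrable_finsetSum _ fun b hb =>
        (A.integrable_optCost (hint b (mem_range.1 hb))).abs).add (integrable_const _)
    refine hI.mono' hm.aestronglyMeasurable (ae_of_all _ fun ω => ?_)
    have h1 : |A.optCost g (A.T i ω + π.b i ω)| ≤ ∑ b ∈ range A.B, |A.optCost g (A.T i ω + b)| :=
      Finset.single_le_sum (f := fun b => |A.optCost g (A.T i ω + b)|) (fun b _ => abs_nonneg _)
        (mem_range.2 (π.b_lt i ω))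
    simp only [φ, Real.norm_eq_abs]
    split_ifs
    · exact (abs_add_le _ _).trans (add_le_add h1 le_rfl)
    · rw [abs_zero]
      exact add_nonneg ((abs_nonneg _).trans h1) (abs_nonneg _)
  have hnonneg : ∀ i, 0 ≤ ∫ ω, φ (π.S i ω, π.b i ω) (A.T i ω) ∂μ := by
    intro i
    rw [(A.integrable_and_integral_indep (hX i) (π.indepFun_of_info (hXi i)) φ (hφi i)).2]
    refine integral_nonneg fun ω => ?_
    simp only [φ, Pi.zero_apply]
    split_ifs
    · rw [integral_add (A.integrable_optCost (hint _ (π.b_lt i ω))) (integrable_const _)]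
      simpa [optCycleCost] using hF _ (π.b_lt i ω)
    · simp
  have hgood' : ∀ᵐ ω ∂μ, ∀ i, ∃ z, g ≤ A.gam (A.T i ω + π.b i ω + z) := by
    have h1 : ∀ᵐ ω ∂μ, ∀ i b, b < A.B → ∃ z, g ≤ A.gam (A.T i ω + b + z) := by
      rw [ae_all_iff]; intro i
      rw [ae_all_iff]; intro b
      rw [ae_all_iff]; intro hb
      exact (A.identDistrib_T 1 i).ae_snd (p := fun n => ∃ z, g ≤ A.gam (n + b + z))
        (MeasurableSet.of_discrete) (hgood b hb)
    filter_upwards [h1] with ω hω i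
    exact hω i _ (π.b_lt i ω)
  have hpath : ∀ᵐ ω ∂μ, ∑ i ∈ range N, φ (π.S i ω, π.b i ω) (A.T i ω) - (U + |l|) * E
      ≤ ∑ i ∈ range N, π.cycleMean g l N i ω := by
    filter_upwards [hgood'] with ω hω
    have hterm : ∀ i, φ (π.S i ω, π.b i ω) (A.T i ω) ≤ π.cycleMean g l N i ω
        + (if π.S i ω < N ∧ ¬ π.S (i + 1) ω < N then (U + |l|) * E else 0) := by
      intro i
      have hSD := π.S_lt_D i ω
      have hDS := π.D_le_S i ω
      have hnn : 0 ≤ (if π.S i ω < N ∧ ¬ π.S (i + 1) ω < N then (U + |l|) * E else 0) := by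
        split_ifs <;> simp [hC]
      have hle := fun z => A.relativeCost_thresholdWait_le (hω i) z
      by_cases h1 : π.D i ω < N
      · simp only [φ, cycleMean, if_pos h1, if_pos (hSD.trans h1), optCost]
        linarith [hle (π.wait N i ω)]
      -- A feature submitted before `N` but delivered later is counted by `φ` and not by
      -- `cycleMean`. This happens at most once, and comparison with zero waiting bounds its cost by
      -- `(U + |l|) * E`.
      · by_cases h2 : π.S i ω < N
        · have h3 : π.S i ω < N ∧ ¬ π.S (i + 1) ω < N := ⟨h2, by omega⟩
          simp only [φ, cycleMean, if_neg h1, if_pos h2, if_pos h3, optCost]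
          have h4 := (abs_le.1 (A.abs_relativeCost_le hu (A.T i ω + π.b i ω) 0)).2
          have h5 : l * E ≤ |l| * E := by gcongr; exact le_abs_self l
          have h6 := hle 0
          simp only [Nat.cast_zero, zero_add] at h4
          linarith
        · simp only [φ, cycleMean, if_neg h1, if_neg h2]
          linarith
    have hs := Finset.sum_le_sum fun i (_ : i ∈ range N) => hterm i
    rw [Finset.sum_add_distrib] at hs
    have hb := sum_indicator_mul_le (P := fun i => π.S i ω < N)
      (fun i h => (π.strictMono_S ω (Nat.lt_succ_self i)).trans h)
      (X := fun _ => (U + |l|) * E) hC N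
    simp only [sub_self, max_self, sum_const_zero, add_zero] at hb
    linarith
  have hI := integrable_finsetSum (range N) fun i _ => hφi i
  have hmono := integral_mono_ae (hI.sub (integrable_const ((U + |l|) * E)))
    (integrable_finsetSum (range N) fun i _ => (π.integral_cycleCost g l N i).2.1) hpath
  have e : ∫ ω, (∑ i ∈ range N, φ (π.S i ω, π.b i ω) (A.T i ω) - (U + |l|) * E) ∂μ
      = ∑ i ∈ range N, ∫ ω, φ (π.S i ω, π.b i ω) (A.T i ω) ∂μ - (U + |l|) * E := by
    rw [integral_sub hI (integrable_const _), integral_finsetSum _ fun i _ => hφi i]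
    simp
  have hs : 0 ≤ ∑ i ∈ range N, ∫ ω, φ (π.S i ω, π.b i ω) (A.T i ω) ∂μ :=
    Finset.sum_nonneg fun i _ => hnonneg i
  have := e.symm.trans_le hmono
  linarith

theorem le_averageCost {g l : ℝ}
    (hgood : ∀ b < A.B, ∀ᵐ ω ∂μ, ∃ z, g ≤ A.gam (A.T 1 ω + b + z))
    (hint : ∀ b < A.B, Integrable (fun ω => (A.thresholdWait g (A.T 1 ω + b) : ℝ)) μ)
    (hF : ∀ b < A.B, 0 ≤ A.optCycleCost g b + l * ∫ ω, (A.T 1 ω : ℝ) ∂μ) :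
    g ≤ π.averageCost l := by
  obtain ⟨U, hU, hu⟩ := A.exists_abs_cost_sub_le g
  refine le_of_forall_pos_le_add fun ε hε => ?_
  rw [← sub_le_iff_le_add]
  have hV : 0 < U + |l| + 1 := by positivity
  -- Half of `ε` pays for the excess over `M`, the other half for the constants once `N` is large;
  -- the `+ 1` keeps the denominator positive.
  obtain ⟨M, hM, hMε⟩ := exists_meanExcess_lt (A.integrable_T 1) (half_pos (div_pos hε hV))
  set E := ∫ ω, (A.T 1 ω : ℝ) ∂μ
  set C := (U + |l|) * E + (U + |l|) * (E + M) with hC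
  refine π.averageCost_ge_of_eventually ?_
  obtain ⟨n₀, hn₀⟩ := exists_nat_ge (C / (ε / 2))
  filter_upwards [eventually_ge_atTop (n₀ + 1)] with N hN
  have hNpos : 0 < N := by omega
  have hN' : (0 : ℝ) < N := by exact_mod_cast hNpos
  have hCN : C ≤ ε / 2 * N := by
    have : (n₀ : ℝ) ≤ N := Nat.cast_le.2 (by omega)
    have := hn₀.trans this
    rw [div_le_iff₀ (by positivity)] at this
    linarith
  have h1 := (abs_le.1 (π.abs_integral_cost_sub_le hu l N hM)).1
  have h2 := π.neg_le_integral_sum_cycleMean hu hgood hint hF N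
  have h3 : (U + |l|) * (N * meanExcess μ (fun ω => (A.T 1 ω : ℝ)) M) ≤ ε / 2 * N := by
    have h4 : (U + |l|) * meanExcess μ (fun ω => (A.T 1 ω : ℝ)) M ≤ ε / 2 := by
      have h5 : 0 ≤ U + |l| := by positivity
      calc _ ≤ (U + |l|) * (ε / (U + |l| + 1) / 2) := by gcongr
        _ ≤ (U + |l| + 1) * (ε / (U + |l| + 1) / 2) :=
          mul_le_mul_of_nonneg_right (le_add_of_nonneg_right zero_le_one) (by positivity)
        _ = ε / 2 := by field_simp
    nlinarith
  rw [π.meanCost_eq g l hNpos]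
  have h6 : -ε ≤ (1 / (N : ℝ)) *
      ∫ ω, ∑ t ∈ range N, (A.w * A.p (π.age t ω) - g + l * π.occupied t ω) ∂μ := by
    rw [one_div, inv_mul_eq_div, le_div_iff₀ hN']
    rw [mul_add] at h1
    linarith
  linarith

end Policy

/-! ### Upper bound for the threshold policy -/

/-- Adding `κ` per slot to the cycle cost makes every cycle mean zero. The cycles begun before `N`
last at least `N` slots in total, so removing this charge saves at least `κ * N`, up to the
straddling cycle. -/
theorem integral_sum_cycleMean_waitPolicy_le (A : Bandit μ) {g l U κ : ℝ}
    (hu : ∀ n, |A.w * A.p n - g| ≤ U) {b : ℕ} (hb : b < A.B)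
    (hint : Integrable (fun ω => (A.thresholdWait g (A.T 1 ω + b) : ℝ)) μ) (hκ : 0 ≤ κ)
    (hF : A.optCycleCost g b + l * ∫ ω, (A.T 1 ω : ℝ) ∂μ
      + κ * ∫ ω, ((A.T 1 ω : ℝ) + A.thresholdWait g (A.T 1 ω + b)) ∂μ = 0)
    (N : ℕ) {M : ℝ} (hM : 0 ≤ M) :
    ∫ ω, ∑ i ∈ range N,
      (A.waitPolicy (fun n => A.thresholdWait g (n + b)) b hb).cycleMean g l N i ω ∂μ
      ≤ 2 * (U + |l|) * (M + N * meanExcess μ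
          (fun ω => (A.thresholdWait g (A.T 1 ω + b) : ℝ) + ∫ ω, (A.T 1 ω : ℝ) ∂μ) M) - κ * N := by
  set E := ∫ ω, (A.T 1 ω : ℝ) ∂μ with hE
  set W : ℕ → ℕ := fun n => A.thresholdWait g (n + b) with hW
  set π := A.waitPolicy W b hb with hπ
  have hE1 : 1 ≤ E := A.one_le_integral_T
  have hU : 0 ≤ U := (abs_nonneg _).trans (hu 0)
  have hWi : ∀ i, Integrable (fun ω => (W (A.T i ω) : ℝ)) μ := fun i =>
    (A.integrable_comp_T_iff (fun n => (W n : ℝ)) i 1).2 hint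
  have hS : ∀ i ω, π.S (i + 1) ω = π.D i ω + W (A.T i ω) := fun i ω => rfl
  have hD : ∀ i ω, π.D i ω = π.S i ω + A.T i ω := fun i ω => rfl
  let φ : ℕ → ℕ → ℝ := fun x n =>
    if x < N then (A.optCost g (n + b) + l * E) + κ * (n + W n) else 0
  have hfi : ∀ i, Integrable
      (fun ω => (A.optCost g (A.T i ω + b) + l * E) + κ * (A.T i ω + W (A.T i ω))) μ := fun i =>
    ((A.integrable_optCost hint).add (integrable_const _)).add
      (((A.integrable_T i).add (hWi i)).const_mul κ)
  have hXi := π.S_measurable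
  have hX := π.measurable_S
  have hφi : ∀ i, Integrable (fun ω => φ (π.S i ω) (A.T i ω)) μ := by
    intro i
    have hm : Measurable fun ω => φ (π.S i ω) (A.T i ω) :=
      (Measurable.of_discrete (f := fun x : ℕ × ℕ => φ x.1 x.2)).comp
        ((hX i).prodMk (A.T_measurable i))
    refine (hfi i).abs.mono' hm.aestronglyMeasurable (ae_of_all _ fun ω => ?_)
    simp only [φ, Real.norm_eq_abs]
    split_ifs
    · exact le_rfl
    · rw [abs_zero]; exact abs_nonneg _
  have hzero : ∀ i, ∫ ω, φ (π.S i ω) (A.T i ω) ∂μ = 0 := by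
    intro i
    rw [(A.integrable_and_integral_indep (hX i) (π.indepFun_of_info (hXi i)) φ (hφi i)).2]
    refine integral_eq_zero_of_ae (ae_of_all _ fun ω => ?_)
    simp only [φ, Pi.zero_apply]
    split_ifs
    · have h1 : Integrable (fun ω => A.optCost g (A.T 1 ω + b) + l * E) μ :=
        (A.integrable_optCost hint).add (integrable_const _)
      have h2 : Integrable (fun ω => κ * ((A.T 1 ω : ℝ) + W (A.T 1 ω))) μ :=
        ((A.integrable_T 1).add (hWi 1)).const_mul κ
      rw [integral_add h1 h2, integral_add (A.integrable_optCost hint) (integrable_const _),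
        integral_const_mul κ, integral_const, probReal_univ, one_smul]
      exact hF
    · simp
  have hpath : ∀ ω, ∑ i ∈ range N, π.cycleMean g l N i ω
      ≤ ∑ i ∈ range N, φ (π.S i ω) (A.T i ω) - κ * N
        + 2 * (U + |l|) * (M + ∑ i ∈ range N, max (((W (A.T i ω) : ℝ) + E) - M) 0) := by
    intro ω
    have hterm : ∀ i, π.cycleMean g l N i ω ≤ φ (π.S i ω) (A.T i ω)
        - κ * (if π.S i ω < N then ((π.S (i + 1) ω : ℝ) - π.S i ω) else 0)
        + 2 * (U + |l|) *
          (if π.S i ω < N ∧ ¬ π.S (i + 1) ω < N then (W (A.T i ω) : ℝ) + E else 0) := by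
      intro i
      have hSD := π.S_lt_D i ω
      have hDi := hD i ω
      have hSi := hS i ω
      have hlen : (π.S (i + 1) ω : ℝ) - π.S i ω = A.T i ω + W (A.T i ω) := by
        rw [hSi, hDi]; push_cast; ring
      have hbi : π.b i ω = b := rfl
      have ho := abs_le.1 (A.abs_optCost_le hu (A.T i ω + b))
      have hl : |l * E| ≤ |l| * E := by rw [abs_mul, abs_of_nonneg (by linarith : 0 ≤ E)]
      have hl' := abs_le.1 hl
      have hWnn : (0 : ℝ) ≤ W (A.T i ω) := Nat.cast_nonneg _
      have hlW : 0 ≤ |l| * W (A.T i ω) := by positivity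
      have hlE : 0 ≤ |l| * E := by positivity
      have hUW : 0 ≤ U * W (A.T i ω) := by positivity
      have hUE : 0 ≤ U * E := by positivity
      change -(U * (W (A.T i ω) + E)) ≤ _ ∧ _ ≤ U * (W (A.T i ω) + E) at ho
      by_cases h2 : π.S i ω < N
      swap
      · have h1 : ¬ π.D i ω < N := by omega
        have h3 : ¬ (π.S i ω < N ∧ ¬ π.S (i + 1) ω < N) := by omega
        simp [φ, Policy.cycleMean, h1, h2]
      rw [if_pos h2, hlen]
      by_cases h1 : π.D i ω < N
      · by_cases h3 : π.S (i + 1) ω < N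
        · have hw : π.wait N i ω = W (A.T i ω) := by
            simp only [Policy.wait]; omega
          have h4 : ¬ (π.S i ω < N ∧ ¬ π.S (i + 1) ω < N) := by omega
          simp only [φ, Policy.cycleMean, if_pos h1, if_pos h2, if_neg h4, hw, hbi]
          have : A.optCost g (A.T i ω + b)
            = A.relativeCost g (A.T i ω + b) (W (A.T i ω)) := rfl
          rw [this]
          linarith
        · have hw : (π.wait N i ω : ℝ) ≤ W (A.T i ω) := by
            rw [Nat.cast_le]; simp only [Policy.wait]; omega
          simp only [φ, Policy.cycleMean, if_pos h1, if_pos h2, if_pos (And.intro h2 h3), hbi]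
          have h5 := (abs_le.1 (A.abs_relativeCost_le hu (A.T i ω + b) (π.wait N i ω))).2
          have h6 : U * (π.wait N i ω + E) ≤ U * (W (A.T i ω) + E) := by gcongr
          linarith
      · have h3 : ¬ π.S (i + 1) ω < N := by omega
        simp only [φ, Policy.cycleMean, if_neg h1, if_pos h2, if_pos (And.intro h2 h3)]
        linarith
    have hs := Finset.sum_le_sum fun i (_ : i ∈ range N) => hterm i
    rw [Finset.sum_add_distrib, Finset.sum_sub_distrib, ← Finset.mul_sum, ← Finset.mul_sum] at hs
    have hb := Policy.sum_indicator_mul_le (P := fun i => π.S i ω < N)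
      (fun i h => (π.strictMono_S ω (Nat.lt_succ_self i)).trans h)
      (X := fun i => (W (A.T i ω) : ℝ) + E) hM N
    have hlen := mul_le_mul_of_nonneg_left (π.le_sum_cycle_length N ω) hκ
    have hb' := mul_le_mul_of_nonneg_left hb (by positivity : 0 ≤ 2 * (U + |l|))
    linarith
  have hX1 : ∀ i, Integrable (fun ω => max (((W (A.T i ω) : ℝ) + E) - M) 0) μ := fun i =>
    integrable_excess ((hWi i).add (integrable_const E)) M
  have hX2 : ∀ i, ∫ ω, max (((W (A.T i ω) : ℝ) + E) - M) 0 ∂μ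
      = meanExcess μ (fun ω => (W (A.T 1 ω) : ℝ) + E) M := fun i =>
    A.integral_comp_T (fun n => max (((W n : ℝ) + E) - M) 0) i 1
  have hI := integrable_finsetSum (range N) fun i _ => hφi i
  have hI1 : Integrable (fun ω => ∑ i ∈ range N, φ (π.S i ω) (A.T i ω) - κ * N) μ :=
    hI.sub (integrable_const _)
  have hI2 : Integrable (fun ω => M + ∑ i ∈ range N, max (((W (A.T i ω) : ℝ) + E) - M) 0) μ :=
    (integrable_const M).add (integrable_finsetSum (range N) fun i _ => hX1 i)
  refine (integral_mono
    (integrable_finsetSum (range N) fun i _ => (π.integral_cycleCost g l N i).2.1)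
    (hI1.add (hI2.const_mul (2 * (U + |l|)))) hpath).trans (le_of_eq ?_)
  simp only [Pi.add_apply]
  rw [integral_add hI1 (hI2.const_mul _), integral_const_mul, integral_sub hI (integrable_const _),
    integral_finsetSum _ fun i _ => hφi i, integral_add (integrable_const M)
      (integrable_finsetSum (range N) fun i _ => hX1 i), integral_finsetSum _ fun i _ => hX1 i]
  simp only [hzero, hX2, integral_const, probReal_univ, one_smul, sum_const, card_range,
    nsmul_eq_mul, mul_zero]
  ring

theorem exists_averageCost_lt (A : Bandit μ) {g l : ℝ} {b : ℕ} (hb : b < A.B)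
    (hint : Integrable (fun ω => (A.thresholdWait g (A.T 1 ω + b) : ℝ)) μ)
    (hF : A.optCycleCost g b + l * ∫ ω, (A.T 1 ω : ℝ) ∂μ < 0) :
    ∃ π : A.Policy, π.averageCost l < g := by
  obtain ⟨U, hU, hu⟩ := A.exists_abs_cost_sub_le g
  set E := ∫ ω, (A.T 1 ω : ℝ) ∂μ with hE
  set L := ∫ ω, ((A.T 1 ω : ℝ) + A.thresholdWait g (A.T 1 ω + b)) ∂μ with hL
  have hL0 : 0 < L := by
    have h1 : L = E + ∫ ω, (A.thresholdWait g (A.T 1 ω + b) : ℝ) ∂μ :=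
      integral_add (A.integrable_T 1) hint
    have h2 : 0 ≤ ∫ ω, (A.thresholdWait g (A.T 1 ω + b) : ℝ) ∂μ :=
      integral_nonneg fun ω => Nat.cast_nonneg _
    linarith [A.one_le_integral_T]
  -- The gain per slot over `g`: the mean surplus of a cycle divided by its mean length.
  set κ := -(A.optCycleCost g b + l * E) / L with hκ
  have hκ0 : 0 < κ := div_pos (by linarith) hL0
  have hFκ : A.optCycleCost g b + l * E + κ * L = 0 := by
    rw [hκ, div_mul_cancel₀ _ hL0.ne']; ring
  have hV : 0 < U + |l| + 1 := by positivity
  have hη : 0 < κ / (8 * (U + |l| + 1)) := by positivity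
  obtain ⟨M, hM, hMη⟩ := exists_meanExcess_lt (A.integrable_T 1) hη
  obtain ⟨M', hM', hMη'⟩ := exists_meanExcess_lt
    (X := fun ω => (A.thresholdWait g (A.T 1 ω + b) : ℝ) + E) (hint.add (integrable_const E)) hη
  set π := A.waitPolicy (fun n => A.thresholdWait g (n + b)) b hb with hπ
  -- The errors use `κ / 8` and `κ / 4` for the two excesses and `κ / 4` for the constants, which
  -- leaves more than `κ / 4` of the gain.
  refine ⟨π, lt_of_le_of_lt (π.averageCost_le_of_eventually (c := g - κ / 4) ?_) (by linarith)⟩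
  set C := (U + |l|) * (E + M) + 2 * (U + |l|) * M' with hC
  obtain ⟨n₀, hn₀⟩ := exists_nat_ge (C / (κ / 4))
  filter_upwards [eventually_ge_atTop (n₀ + 1)] with N hN
  have hNpos : 0 < N := by omega
  have hN' : (0 : ℝ) < N := by exact_mod_cast hNpos
  have hCN : C ≤ κ / 4 * N := by
    have : (n₀ : ℝ) ≤ N := Nat.cast_le.2 (by omega)
    have := hn₀.trans this
    rw [div_le_iff₀ (by positivity)] at this
    linarith
  have h1 := (abs_le.1 (π.abs_integral_cost_sub_le hu l N hM)).2
  have h2 := A.integral_sum_cycleMean_waitPolicy_le hu hb hint hκ0.le hFκ N hM'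
  have hsmall : ∀ e, e < κ / (8 * (U + |l| + 1)) → (U + |l|) * (N * e) ≤ κ / 8 * N := by
    intro e he
    have h5 : 0 ≤ U + |l| := by positivity
    have h4 : (U + |l|) * e ≤ κ / 8 := by
      calc _ ≤ (U + |l|) * (κ / (8 * (U + |l| + 1))) := by gcongr
        _ ≤ (U + |l| + 1) * (κ / (8 * (U + |l| + 1))) :=
          mul_le_mul_of_nonneg_right (le_add_of_nonneg_right zero_le_one) hη.le
        _ = κ / 8 := by field_simp
    nlinarith
  have h3 := hsmall _ hMη
  have h3' := hsmall _ hMη'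
  rw [π.meanCost_eq g l hNpos]
  have h6 : (1 / (N : ℝ)) *
      ∫ ω, ∑ t ∈ range N, (A.w * A.p (π.age t ω) - g + l * π.occupied t ω) ∂μ ≤ -(κ / 4) := by
    rw [one_div, inv_mul_eq_div, div_le_iff₀ hN']
    rw [mul_add] at h1
    have := mul_pos hκ0 hN'
    linarith
  linarith

end Bandit

namespace Bandit

variable {Ω : Type*} [mΩ : MeasurableSpace Ω] {μ : Measure Ω}

/-! ### The threshold policy -/

lemma exists_threshold_iff (A : Bandit μ) (b : ℕ) (β : ℝ) (i : ℕ) (ω : Ω) :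
    (∃ t : ℕ, A.thresholdD b β i ω ≤ t ∧ β ≤ A.gam (t - A.thresholdS b β i ω + b)) ↔
      ∃ z, β ≤ A.gam (A.T i ω + b + z) := by
  unfold thresholdD
  constructor
  · rintro ⟨t, h1, h2⟩
    refine ⟨t - (A.thresholdS b β i ω + A.T i ω), ?_⟩
    convert h2 using 2
    omega
  · rintro ⟨z, hz⟩
    refine ⟨A.thresholdS b β i ω + A.T i ω + z, by omega, ?_⟩
    convert hz using 2
    omega

lemma thresholdS_succ (A : Bandit μ) {b : ℕ} {β : ℝ} {i : ℕ} {ω : Ω}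
    (h : ∃ z, β ≤ A.gam (A.T i ω + b + z)) :
    A.thresholdS b β (i + 1) ω
      = A.thresholdD b β i ω + A.thresholdWait β (A.T i ω + b) := by
  have hmem : β ≤ A.gam (A.T i ω + b + A.thresholdWait β (A.T i ω + b)) :=
    Nat.sInf_mem (s := {z | β ≤ A.gam (A.T i ω + b + z)}) h
  refine IsLeast.csInf_eq ⟨⟨Nat.le_add_right _ _, ?_⟩, ?_⟩
  · convert hmem using 2
    unfold thresholdD
    omega
  · rintro t ⟨h1, h2⟩
    have : A.thresholdWait β (A.T i ω + b) ≤ t - (A.thresholdS b β i ω + A.T i ω) := by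
      refine Nat.sInf_le (s := {z | β ≤ A.gam (A.T i ω + b + z)}) ?_
      change β ≤ _
      convert h2 using 2
      omega
    unfold thresholdD
    omega

lemma thresholdD_sub (A : Bandit μ) {b : ℕ} {β : ℝ} {i : ℕ} {ω : Ω}
    (h : ∃ z, β ≤ A.gam (A.T i ω + b + z)) :
    (A.thresholdD b β (i + 1) ω : ℝ) - A.thresholdD b β i ω
      = A.thresholdWait β (A.T i ω + b) + A.T (i + 1) ω := by
  have h1 : A.thresholdD b β (i + 1) ω = A.thresholdS b β (i + 1) ω + A.T (i + 1) ω := rfl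
  rw [h1, A.thresholdS_succ h]
  push_cast
  ring

lemma sum_Ico_threshold (A : Bandit μ) {b : ℕ} {β : ℝ} {i : ℕ} {ω : Ω}
    (h : ∃ z, β ≤ A.gam (A.T i ω + b + z)) :
    ∑ t ∈ Ico (A.thresholdD b β i ω) (A.thresholdD b β (i + 1) ω),
        A.w * A.p (t - A.thresholdS b β i ω + b)
      = ∑ k ∈ range (A.thresholdWait β (A.T i ω + b) + A.T (i + 1) ω),
          A.w * A.p (A.T i ω + b + k) := by
  have h1 : A.thresholdD b β (i + 1) ω = A.thresholdS b β (i + 1) ω + A.T (i + 1) ω := rfl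
  rw [h1, A.thresholdS_succ h, Finset.sum_Ico_eq_sum_range]
  have h2 : A.thresholdD b β i ω + A.thresholdWait β (A.T i ω + b) + A.T (i + 1) ω
      - A.thresholdD b β i ω = A.thresholdWait β (A.T i ω + b) + A.T (i + 1) ω := by omega
  rw [h2]
  refine Finset.sum_congr rfl fun k _ => ?_
  congr 2
  unfold thresholdD
  omega

namespace ThresholdFinite

variable {A : Bandit μ} {b i : ℕ} {β : ℝ}

/-- Existence of the threshold slot depends on `A.T i` alone, so equality in law carries it from the
`i`-th interval to every index. -/
lemma ae_exists (h : A.ThresholdFinite b β i) (j : ℕ) :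
    ∀ᵐ ω ∂μ, ∃ z, β ≤ A.gam (A.T j ω + b + z) := by
  refine (A.identDistrib_T i j).ae_snd (p := fun n => ∃ z, β ≤ A.gam (n + b + z))
    MeasurableSet.of_discrete ?_
  filter_upwards [h.1] with ω hω
  exact (A.exists_threshold_iff b β i ω).1 hω

lemma integrable_thresholdWait (h : A.ThresholdFinite b β i) (j : ℕ) :
    Integrable (fun ω => (A.thresholdWait β (A.T j ω + b) : ℝ)) μ := by
  refine (A.integrable_comp_T_iff (fun n => (A.thresholdWait β (n + b) : ℝ)) j i).2 ?_
  refine (h.2.sub (A.integrable_T (i + 1))).congr ?_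
  filter_upwards [h.ae_exists i] with ω hω
  simp only [Pi.sub_apply]
  rw [A.thresholdD_sub hω]
  ring

end ThresholdFinite

variable [IsProbabilityMeasure μ]

/-- Both integrals in `bufferIndex` concern the same interval; together they give minus the mean of
`w p - g` summed over it. Its two transmission times are independent, and integrating the second out
yields `optCost`. -/
lemma bufferIndex_eq (A : Bandit μ) {i b δ : ℕ} (h : A.ThresholdFinite b (A.gam δ) i) :
    A.bufferIndex i b δ = -A.optCycleCost (A.gam δ) b / ∫ ω, (A.T 1 ω : ℝ) ∂μ := by
  set g := A.gam δ with hg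
  obtain ⟨U, hU, hu⟩ := A.exists_abs_cost_sub_le g
  have hwait := h.integrable_thresholdWait i
  have hlen : Integrable
      (fun ω => (A.thresholdWait g (A.T i ω + b) : ℝ) + A.T (i + 1) ω) μ :=
    hwait.add (A.integrable_T (i + 1))
  let φ : ℕ → ℕ → ℝ := fun n m =>
    ∑ k ∈ range (A.thresholdWait g (n + b) + m), (A.w * A.p (n + b + k) - g)
  have hφ : Integrable (fun ω => φ (A.T i ω) (A.T (i + 1) ω)) μ := by
    refine (hlen.const_mul U).mono'
      ((Measurable.of_discrete (f := fun x : ℕ × ℕ => φ x.1 x.2)).comp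
        ((A.T_measurable i).prodMk (A.T_measurable (i + 1)))).aestronglyMeasurable
      (ae_of_all _ fun ω => ?_)
    have := abs_sum_range_le (u := fun k => A.w * A.p (A.T i ω + b + k) - g) (fun _ => hu _)
      (A.thresholdWait g (A.T i ω + b) + A.T (i + 1) ω)
    push_cast at this
    exact this
  have hind : IndepFun (A.T i) (A.T (i + 1)) μ := A.T_indep.indepFun (by omega)
  have key := (A.integrable_and_integral_indep (A.T_measurable i) hind φ hφ).2
  have hopt : ∫ ω, ∫ ω', φ (A.T i ω) (A.T 1 ω') ∂μ ∂μ = A.optCycleCost g b :=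
    A.integral_comp_T (fun n => A.optCost g (n + b)) i 1
  rw [hopt] at key
  have e1 : ∫ ω, ((A.thresholdD b g (i + 1) ω : ℝ) - A.thresholdD b g i ω) ∂μ
      = ∫ ω, ((A.thresholdWait g (A.T i ω + b) : ℝ) + A.T (i + 1) ω) ∂μ := by
    refine integral_congr_ae ?_
    filter_upwards [h.ae_exists i] with ω hω
    exact A.thresholdD_sub hω
  have e2 : ∫ ω, ∑ t ∈ Ico (A.thresholdD b g i ω) (A.thresholdD b g (i + 1) ω),
        A.w * A.p (t - A.thresholdS b g i ω + b) ∂μ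
      = ∫ ω, (φ (A.T i ω) (A.T (i + 1) ω)
          + g * ((A.thresholdWait g (A.T i ω + b) : ℝ) + A.T (i + 1) ω)) ∂μ := by
    refine integral_congr_ae ?_
    filter_upwards [h.ae_exists i] with ω hω
    rw [A.sum_Ico_threshold hω]
    simp only [φ, Finset.sum_sub_distrib, sum_const, card_range, nsmul_eq_mul]
    push_cast
    ring
  rw [integral_add hφ (hlen.const_mul g), integral_const_mul, key] at e2
  rw [bufferIndex, ← hg, e1, e2]
  ring

/-! ### The Whittle index -/

lemma relativeCost_eq_windowAverage (A : Bandit μ) (g : ℝ) (δ τ : ℕ) :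
    A.relativeCost g δ τ = A.relativeCost g δ 0 + τ * (A.windowAverage δ τ - g) := by
  rw [relativeCost_add, sum_meanError_sub]

/-- Attainment matters when the gain equals `A.gam δ`: an attaining window then makes waiting
exactly as cheap as submitting. -/
lemma mem_passiveSet_iff (A : Bandit μ) {δ : ℕ}
    (hatt : ∃ τ : ℕ, 1 ≤ τ ∧ A.windowAverage δ τ = A.gam δ) (l : ℝ) :
    (δ, 0) ∈ A.passiveSet l ↔ A.gam δ ≤ A.optValue l := by
  simp only [passiveSet, Set.mem_ofPred_eq, lt_irrefl, false_or]
  constructor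
  · intro h
    by_contra! hlt
    have hpos : 0 < A.gam δ - A.optValue l := sub_pos.2 hlt
    have h1 : ((A.relativeCost (A.optValue l) δ 0 + (A.gam δ - A.optValue l) : ℝ) : EReal)
        ≤ ⨅ τ : ℕ+, (A.relativeCost (A.optValue l) δ τ : EReal) := by
      refine le_iInf fun τ => EReal.coe_le_coe_iff.2 ?_
      rw [A.relativeCost_eq_windowAverage _ δ τ]
      have h2 := A.gam_le_windowAverage δ τ.pos
      have h3 : (1 : ℝ) ≤ (τ : ℕ) := Nat.one_le_cast.2 τ.pos
      nlinarith
    have := EReal.coe_le_coe_iff.1 (h1.trans h)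
    linarith
  · intro h
    obtain ⟨τ, hτ, hw⟩ := hatt
    refine (iInf_le _ (⟨τ, hτ⟩ : ℕ+)).trans (EReal.coe_le_coe_iff.2 ?_)
    change A.relativeCost (A.optValue l) δ τ ≤ _
    rw [A.relativeCost_eq_windowAverage _ δ τ, hw]
    have : (0 : ℝ) ≤ τ := Nat.cast_nonneg _
    nlinarith

lemma gam_le_optValue_iff (A : Bandit μ) {g : ℝ}
    (hgood : ∀ b < A.B, ∀ᵐ ω ∂μ, ∃ z, g ≤ A.gam (A.T 1 ω + b + z))
    (hint : ∀ b < A.B, Integrable (fun ω => (A.thresholdWait g (A.T 1 ω + b) : ℝ)) μ) (l : ℝ) :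
    g ≤ A.optValue l ↔
      ∀ b < A.B, -A.optCycleCost g b / ∫ ω, (A.T 1 ω : ℝ) ∂μ ≤ l := by
  have hE : 0 < ∫ ω, (A.T 1 ω : ℝ) ∂μ := by linarith [A.one_le_integral_T]
  constructor
  · intro h b hb
    by_contra! hlt
    rw [lt_div_iff₀ hE] at hlt
    obtain ⟨π, hπ⟩ := A.exists_averageCost_lt (l := l) hb (hint b hb) (by linarith)
    exact absurd (h.trans (ciInf_le (A.bddBelow_averageCost l) π)) (not_le.2 hπ)
  · intro h
    refine le_ciInf fun π => π.le_averageCost hgood hint fun b hb => ?_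
    have := h b hb
    rw [div_le_iff₀ hE] at this
    linarith

theorem whittleIndex_idle (A : Bandit μ) {δ i : ℕ}
    (hatt : ∃ τ : ℕ, 1 ≤ τ ∧ A.windowAverage δ τ = A.gam δ)
    (hfin : ∀ b : ℕ, b < A.B → A.ThresholdFinite b (A.gam δ) i) :
    A.whittleIndex δ 0 = ⨆ b : Fin A.B, (A.bufferIndex i b δ : EReal) := by
  have : Nonempty (Fin A.B) := ⟨⟨0, A.B_pos⟩⟩
  obtain ⟨b₀, hb₀⟩ := Finite.exists_max fun b : Fin A.B => A.bufferIndex i b δ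
  have hsup : ⨆ b : Fin A.B, (A.bufferIndex i b δ : EReal) = (A.bufferIndex i b₀ δ : EReal) :=
    le_antisymm (iSup_le fun b => EReal.coe_le_coe_iff.2 (hb₀ b))
      (le_iSup (fun b : Fin A.B => (A.bufferIndex i b δ : EReal)) b₀)
  have hiff : ∀ l : ℝ, (δ, 0) ∈ A.passiveSet l ↔ A.bufferIndex i b₀ δ ≤ l := by
    intro l
    rw [A.mem_passiveSet_iff hatt, A.gam_le_optValue_iff
      (fun b hb => (hfin b hb).ae_exists 1) fun b hb => (hfin b hb).integrable_thresholdWait 1]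
    constructor
    · intro h
      rw [A.bufferIndex_eq (hfin _ b₀.2)]
      exact h _ b₀.2
    · intro h b hb
      rw [← A.bufferIndex_eq (hfin b hb)]
      exact (hb₀ ⟨b, hb⟩).trans h
  rw [hsup, whittleIndex]
  simp only [hiff]
  refine IsLeast.csInf_eq ⟨⟨_, le_refl (A.bufferIndex i b₀ δ), rfl⟩, ?_⟩
  rintro _ ⟨l, hl, rfl⟩
  exact EReal.coe_le_coe_iff.2 hl

omit [IsProbabilityMeasure μ] in
theorem whittleIndex_busy (A : Bandit μ) (δ : ℕ) {d : ℕ} (hd : 0 < d) :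
    A.whittleIndex δ d = ⊥ := by
  have h : ∀ l : ℝ, (δ, d) ∈ A.passiveSet l := fun l => Or.inl hd
  rw [whittleIndex, sInf_eq_bot]
  intro x hx
  obtain ⟨l, hl⟩ := EReal.lt_iff_exists_real_btwn.1 hx
  exact ⟨l, ⟨l, h l, rfl⟩, hl.2⟩

/-! ### Ageing forever -/

/-- Partial sums of `w p - g` grow linearly by the liminf. Delaying the path by a transmission time
changes their mean by a bounded amount, so the sums of mean errors inherit the growth. -/
lemma exists_linear_growth (A : Bandit μ) {g : ℝ} (h : g < A.agingAverage) :
    ∃ ε : ℝ, 0 < ε ∧ ∃ C : ℝ, ∀ n : ℕ, ε * n - C ≤ ∑ k ∈ range n, (A.meanError k - g) := by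
  obtain ⟨U, hU, hu⟩ := A.exists_abs_cost_sub_le g
  obtain ⟨U', hU', hu'⟩ := A.exists_abs_cost_sub_le 0
  obtain ⟨c, hgc, hc⟩ := exists_between h
  have hbdd : IsBoundedUnder (· ≥ ·) atTop
      fun n : ℕ => (1 / (n : ℝ)) * ∑ k ∈ range n, A.w * A.p k := by
    refine isBoundedUnder_of ⟨-U', fun n => ?_⟩
    rcases Nat.eq_zero_or_pos n with rfl | hn
    · simpa using hU'
    · have h1 := abs_sum_range_le (u := fun k => A.w * A.p k) (fun k => by simpa using hu' k) n
      rw [ge_iff_le, one_div, inv_mul_eq_div, le_div_iff₀ (by positivity)]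
      linarith [(abs_le.1 h1).1]
  obtain ⟨n₀, hn₀⟩ := eventually_atTop.1 (eventually_lt_of_lt_liminf hc hbdd)
  have hE : 0 ≤ ∫ ω, (A.T 1 ω : ℝ) ∂μ := by linarith [A.one_le_integral_T]
  have hshift : ∀ n : ℕ, ∑ k ∈ range n, (A.w * A.p k - g) - 2 * U * ∫ ω, (A.T 1 ω : ℝ) ∂μ
      ≤ ∑ k ∈ range n, (A.meanError k - g) := by
    intro n
    have h1 := A.relativeCost_add g 0 n
    simp only [zero_add] at h1
    have h2 := (abs_le.1 (A.abs_relativeCost_le hu 0 0)).2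
    have h3 : ∑ k ∈ range n, (A.w * A.p k - g) - U * ∫ ω, (A.T 1 ω : ℝ) ∂μ
        ≤ A.relativeCost g 0 n := by
      have hI : Integrable
          (fun ω => ∑ k ∈ range n, (A.w * A.p k - g) - U * (A.T 1 ω : ℝ)) μ :=
        (integrable_const _).sub ((A.integrable_T 1).const_mul U)
      have h4 := integral_mono hI (A.integrable_sum_range g 0 n 1) fun ω => by
        have h5 := (abs_le.1 (Policy.abs_sum_range_sub_le hu
          (Nat.le_add_right n (A.T 1 ω)))).2
        push_cast at h5
        simp only [zero_add]
        linarith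
      rw [integral_sub (integrable_const _) ((A.integrable_T 1).const_mul U),
        integral_const_mul, integral_const, probReal_univ, one_smul] at h4
      exact h4
    simp only [Nat.cast_zero, zero_add] at h2
    linarith
  -- The first constant pays for the delay; the other two cover the `n` below `n₀`, where only the
  -- bound `U` is available.
  refine ⟨c - g, sub_pos.2 hgc,
    2 * U * ∫ ω, (A.T 1 ω : ℝ) ∂μ + (c - g) * n₀ + U * n₀, fun n => ?_⟩
  rcases Nat.lt_or_ge n n₀ with hn | hn
  · have h1 := (abs_le.1 (abs_sum_range_le (A.abs_meanError_sub_le hu) n)).1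
    have h2 : (n : ℝ) ≤ n₀ := Nat.cast_le.2 hn.le
    have h3 := mul_le_mul_of_nonneg_left h2 hU
    have h4 := mul_le_mul_of_nonneg_left h2 (sub_pos.2 hgc).le
    have h5 : 0 ≤ 2 * U * ∫ ω, (A.T 1 ω : ℝ) ∂μ := by positivity
    linarith
  · have h1 := hshift n
    have h2 : (c - g) * n ≤ ∑ k ∈ range n, (A.w * A.p k - g) := by
      rcases Nat.eq_zero_or_pos n with rfl | hpos
      · simp
      · have h3 := hn₀ n hn
        rw [one_div, inv_mul_eq_div, lt_div_iff₀ (by positivity)] at h3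
        rw [Finset.sum_sub_distrib, sum_const, card_range, nsmul_eq_mul]
        linarith
    have h4 : 0 ≤ (c - g) * n₀ := mul_nonneg (sub_pos.2 hgc).le (Nat.cast_nonneg _)
    have h5 : 0 ≤ U * n₀ := by positivity
    linarith

omit [IsProbabilityMeasure μ] in
lemma sum_shift_meanError (A : Bandit μ) (g : ℝ) (a n : ℕ) :
    ∑ k ∈ range (a + n), (A.meanError k - g)
      = ∑ k ∈ range a, (A.meanError k - g) + n * (A.windowAverage a n - g) := by
  rw [Finset.sum_range_add, sum_meanError_sub]

/-- By linear growth, long windows have average at least `A.gam δ + ε / 2`, so the infimum is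
decided by finitely many short ones. -/
lemma exists_windowAverage_eq_gam (A : Bandit μ) {δ : ℕ} (h : A.gam δ < A.agingAverage) :
    ∃ τ : ℕ, 1 ≤ τ ∧ A.windowAverage δ τ = A.gam δ := by
  obtain ⟨ε, hε, C, hC⟩ := A.exists_linear_growth h
  by_contra! hne
  have hlt : ∀ τ : ℕ, 1 ≤ τ → A.gam δ < A.windowAverage δ τ := fun τ hτ =>
    lt_of_le_of_ne (A.gam_le_windowAverage δ hτ) (hne τ hτ).symm
  set H := ∑ k ∈ range δ, (A.meanError k - A.gam δ) with hH
  obtain ⟨τ₀, hτ₀⟩ := exists_nat_ge ((C + H) / (ε / 2))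
  rw [div_le_iff₀ (by positivity)] at hτ₀
  obtain ⟨τ₁, hτ₁, hmin⟩ := Finset.exists_min_image (Icc 1 (τ₀ + 1)) (A.windowAverage δ)
    ⟨1, by simp⟩
  have hm := hlt τ₁ (mem_Icc.1 hτ₁).1
  have hle : min (A.windowAverage δ τ₁) (A.gam δ + ε / 2) ≤ A.gam δ := by
    refine le_ciInf fun τ => ?_
    rcases Nat.lt_or_ge (τ₀ + 1) τ with hτ | hτ
    · refine (min_le_right _ _).trans ?_
      have h1 := hC (δ + τ)
      rw [sum_shift_meanError] at h1
      have hτ' : (τ₀ : ℝ) ≤ (τ : ℕ) := Nat.cast_le.2 (by omega)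
      have hpos : (0 : ℝ) < (τ : ℕ) := Nat.cast_pos.2 τ.pos
      have hδ : 0 ≤ ε * (δ : ℝ) := by positivity
      have h3 : ε / 2 * τ₀ ≤ ε / 2 * (τ : ℕ) := by gcongr
      push_cast at h1
      have h2 : (ε / 2) * (τ : ℕ) ≤ (A.windowAverage δ τ - A.gam δ) * (τ : ℕ) := by
        linarith
      linarith [le_of_mul_le_mul_right h2 hpos]
    · exact (min_le_left _ _).trans (hmin τ (mem_Icc.2 ⟨τ.pos, hτ⟩))
  exact absurd hle (not_le.2 (lt_min hm (by linarith)))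

/-- Let `m ≥ a` minimize the partial sums `H`. No window starting at `m` averages below `g`, so the
threshold is reached by age `m`. Comparing `ε * m - C ≤ H m` with `H m ≤ H a ≤ U * a` bounds `m`
linearly in `a`. -/
lemma exists_thresholdWait_le (A : Bandit μ) {g : ℝ} (h : g < A.agingAverage) :
    ∃ K C : ℝ, ∀ a : ℕ, (∃ z, g ≤ A.gam (a + z)) ∧ (A.thresholdWait g a : ℝ) ≤ K * a + C := by
  obtain ⟨ε, hε, C, hC⟩ := A.exists_linear_growth h
  obtain ⟨U, hU, hu⟩ := A.exists_abs_cost_sub_le g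
  refine ⟨U / ε, C / ε, fun a => ?_⟩
  set H : ℕ → ℝ := fun n => ∑ k ∈ range n, (A.meanError k - g) with hH
  have hHa : H a ≤ U * a := (abs_le.1 (abs_sum_range_le (A.abs_meanError_sub_le hu) a)).2
  obtain ⟨n₀, hn₀⟩ := exists_nat_ge ((H a + C) / ε)
  rw [div_le_iff₀ hε] at hn₀
  obtain ⟨m, hm, hmin⟩ := Finset.exists_min_image (Icc a (a + n₀)) H ⟨a, by simp⟩
  obtain ⟨ham, -⟩ := mem_Icc.1 hm
  have hma : H m ≤ H a := hmin a (by simp)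
  have hall : ∀ n, m ≤ n → H m ≤ H n := by
    intro n hn
    rcases Nat.lt_or_ge (a + n₀) n with h1 | h1
    · have h2 : (n₀ : ℝ) ≤ n := Nat.cast_le.2 (by omega)
      have h3 := hC n
      nlinarith
    · exact hmin n (mem_Icc.2 ⟨by omega, h1⟩)
  have hgam : g ≤ A.gam m := by
    refine le_ciInf fun τ => ?_
    have h1 := hall (m + τ) (Nat.le_add_right _ _)
    simp only [hH] at h1
    rw [sum_shift_meanError] at h1
    have hpos : (0 : ℝ) < (τ : ℕ) := Nat.cast_pos.2 τ.pos
    have h2 : 0 ≤ (τ : ℕ) * (A.windowAverage m τ - g) := by linarith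
    linarith [nonneg_of_mul_nonneg_right h2 hpos]
  have hgam' : g ≤ A.gam (a + (m - a)) := by rwa [Nat.add_sub_of_le ham]
  refine ⟨⟨m - a, hgam'⟩, ?_⟩
  have h1 : A.thresholdWait g a ≤ m :=
    (Nat.sInf_le (s := {z | g ≤ A.gam (a + z)}) hgam').trans (Nat.sub_le _ _)
  have h2 : (A.thresholdWait g a : ℝ) ≤ m := Nat.cast_le.2 h1
  refine h2.trans ?_
  rw [div_mul_eq_mul_div, ← add_div, le_div_iff₀ hε]
  linarith [hC m]

lemma thresholdFinite_of_lt_agingAverage (A : Bandit μ) {g : ℝ} (h : g < A.agingAverage)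
    (b i : ℕ) : A.ThresholdFinite b g i := by
  obtain ⟨K, C, hKC⟩ := A.exists_thresholdWait_le h
  have hex : ∀ ω, ∃ z, g ≤ A.gam (A.T i ω + b + z) := fun ω => (hKC _).1
  refine ⟨ae_of_all _ fun ω => (A.exists_threshold_iff b g i ω).2 (hex ω), ?_⟩
  simp only [fun ω => A.thresholdD_sub (hex ω)]
  refine Integrable.add ?_ (A.integrable_T (i + 1))
  refine ((((A.integrable_T i).add (integrable_const (b : ℝ))).const_mul K).add
    (integrable_const C)).mono'
    (A.measurable_comp_T (fun n => (A.thresholdWait g (n + b) : ℝ)) i).aestronglyMeasurable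
    (ae_of_all _ fun ω => ?_)
  have := (hKC (A.T i ω + b)).2
  push_cast at this
  rw [Real.norm_eq_abs, Nat.abs_cast]
  exact this

end Bandit

theorem theorem10 {Ω : Type*} [MeasurableSpace Ω] (μ : Measure Ω) [IsProbabilityMeasure μ]
    (A : Bandit μ) (δ : ℕ) :
    -- if ageing forever is worse than `γ(δ)`, the expressions below are well defined
    (A.gam δ < A.agingAverage →
      (∃ τ : ℕ, 1 ≤ τ ∧ A.windowAverage δ τ = A.gam δ) ∧
      ∀ i b : ℕ, b < A.B → A.ThresholdFinite b (A.gam δ) i) ∧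
    -- (a) idle state
    (∀ i : ℕ, (∃ τ : ℕ, 1 ≤ τ ∧ A.windowAverage δ τ = A.gam δ) →
      (∀ b : ℕ, b < A.B → A.ThresholdFinite b (A.gam δ) i) →
      A.whittleIndex δ 0 = ⨆ b : Fin A.B, (A.bufferIndex i b δ : EReal)) ∧
    -- (b) a feature is in service
    (∀ d : ℕ, 0 < d → A.whittleIndex δ d = ⊥) := by
  exact ⟨fun h => ⟨A.exists_windowAverage_eq_gam h,
      fun i b _ => A.thresholdFinite_of_lt_agingAverage h b i⟩,
    fun _ hatt hfin => A.whittleIndex_idle hatt hfin,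
    fun _ hd => A.whittleIndex_busy δ hd⟩
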